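/- Let $d=2$, and let $\mathbb G=\{\mathcal G_i\}_{i\in I}$, $\mathcal G_i(X)=U_iXU_i^\dagger$, be a finite family of single-qubit unitary channels ($I\neq\emptyset$) forming a unitary 2-design, i.e. for every linear map $\Lambda$ on $2\times2$ matrices the twirl $\frac1{|I|}\sum_i \mathcal G_i\Lambda\mathcal G_i^\dagger$ has the form $X\mapsto aX+b\,\mathrm{tr}(X)\,\mathbb I$. Let $\tilde{\mathbb G}=\{\tilde{\mathcal G}_i\}_{i\in I}$ be a noisy gate-set, each $\tilde{\mathcal G}_i$ being a completely positive trace-preserving map. For a circuit length $m$ and a target gate-set $\mathbb H=\{\mathcal H_i\}_{i\in I}$ define the gate-set circuit fidelity $$\mathcal F(\tilde{\mathbb G},\mathbb H,m)=\frac1{|I|^m}\sum_{(i_1,\dots,i_m)\in I^m}\int \mathrm{tr}\Big[\big(\tilde{\mathcal G}_{i_m}\cdots\tilde{\mathcal G}_{i_1}(\psi)\big)^\dagger\,\mathcal H_{i_m}\cdots\mathcal H_{i_1}(\psi)\Big]\,d\psi ,$$ where $\psi$ is uniformly distributed over the pure states. Let $\mathcal T=\frac1{|I|}\sum_i (\boldsymbol{\mathcal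 G}_i\boldsymbol\Pi_{\rm tr})\otimes\tilde{\boldsymbol{\mathcal G}}_i$ be the twirling superchannel, where bold letters denote Liouville matrices in the normalized Pauli basis and $\Pi_{\rm tr}(X)=X-\mathrm{tr}(X)\,\mathbb I/d$. The RB decay parameter $p$ is the highest eigenvalue of $\mathcal T$: a real eigenvalue $p$ such that every eigenvalue of $\mathcal T$ has modulus at most $p$. There are absolute constants $\varepsilon,K>0$ such that for all such $\mathbb G,\tilde{\mathbb G}$ with $1-\mathcal F(\tilde{\mathbb G},\mathbb G,1)\le\varepsilon$, the RB decay parameter $p$ exists, and there is a unitary channel $\mathcal U(X)=VXV^\dagger$ such that for every circuit length $m\ge 0$ $$\left|\mathcal F(\tilde{\mathbb G},\mathcal U\mathbb G\mathcal U^\dagger,m)-\left(\frac1d+\frac{d-1}d\,p^m\right)\right|\le K(1-p)^2 ,$$ where $\mathcal U\mathbb G\mathcal U^\dagger=\{\mathcal U\mathcal G_i\mathcal U^\dagger\}_{i\in I}$. -/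

import Mathlib

open scoped Matrix Kronecker ComplexOrder
open MeasureTheory

namespace QubitRB

noncomputable section

/-- Operators on the Hilbert space `ℂ²` of one qubit (dimension `d = 2`). -/
abbrev Op : Type := Matrix (Fin 2) (Fin 2) ℂ

/-- Linear maps on qubit operators. The monoid structure is composition. -/
abbrev SuperOp : Type := Module.End ℂ Op

/-- The amplification `Φ ⊗ id` of `Φ` to operators on `ℂ² ⊗ ℂⁿ`. -/
def amplify (n : ℕ) (Φ : SuperOp) (X : Matrix (Fin 2 × Fin n) (Fin 2 × Fin n) ℂ) :
    Matrix (Fin 2 × Fin n) (Fin 2 × Fin n) ℂ :=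
  Matrix.of fun i j => Φ (Matrix.of fun k l => X (k, i.2) (l, j.2)) i.1 j.1

/-- A qubit channel: a completely positive, trace-preserving linear map. -/
structure IsChannel (Φ : SuperOp) : Prop where
  completelyPositive : ∀ (n : ℕ) (X : Matrix (Fin 2 × Fin n) (Fin 2 × Fin n) ℂ),
    X.PosSemidef → (amplify n Φ X).PosSemidef
  tracePreserving : ∀ X : Op, (Φ X).trace = X.trace

/-- The unitary channel `X ↦ u X u†`. Its adjoint is `unitaryChannel u⁻¹`. -/
def unitaryChannel (u : Matrix.unitaryGroup (Fin 2) ℂ) : SuperOp where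
  toFun X := (u : Op) * X * (u : Op)ᴴ
  map_add' X Y := by rw [mul_add, add_mul]
  map_smul' c X := by simp

/-- The pure state `|ψ⟩⟨ψ|` of a vector `ψ`. -/
def pureState (ψ : EuclideanSpace ℂ (Fin 2)) : Op :=
  Matrix.of fun i j => ψ i * star (ψ j)

/-- The Hilbert-Schmidt inner product `⟨M₁, M₂⟩ = tr (M₁† M₂)`. -/
def hsInner (M₁ M₂ : Op) : ℂ := (M₁ᴴ * M₂).trace

/-- Average fidelity of `Cn` to `C`: the mean of `⟨Cn(ψ), C(ψ)⟩` over pure states `ψ`, distributed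
uniformly on the unit sphere of `ℂ²`. (For channels the inner product is a real number.) -/
def avgFidelity (Cn C : SuperOp) : ℝ :=
  ⨍ ψ : Metric.sphere (0 : EuclideanSpace ℂ (Fin 2)) 1,
    (hsInner (Cn (pureState ψ)) (C (pureState ψ))).re
    ∂((volume : Measure (EuclideanSpace ℂ (Fin 2))).toSphere)

/-- The circuit `G_{s (m-1)} ∘ ⋯ ∘ G_{s 1} ∘ G_{s 0}`. -/
def circuit {ι : Type*} (G : ι → SuperOp) : (m : ℕ) → (Fin m → ι) → SuperOp
  | 0, _ => 1
  | m + 1, s => G (s (Fin.last m)) * circuit G m (fun k => s k.castSucc)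

/-- Gate-set circuit fidelity: the expected average fidelity of the noisy circuit to the target
circuit, over `m` independent uniformly random gate labels. -/
def gateSetFidelity {ι : Type*} [Fintype ι] (Gn G : ι → SuperOp) (m : ℕ) : ℝ :=
  (∑ s : Fin m → ι, avgFidelity (circuit Gn m s) (circuit G m s)) / (Fintype.card ι : ℝ) ^ m

/-- The ideal gate-set given by a family of unitaries. -/
def idealGates {ι : Type*} (u : ι → Matrix.unitaryGroup (Fin 2) ℂ) : ι → SuperOp :=
  fun i => unitaryChannel (u i)

/-- The rotated gate-set `𝒱 𝔾 𝒱†`. -/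
def rotate {ι : Type*} (v : Matrix.unitaryGroup (Fin 2) ℂ) (G : ι → SuperOp) : ι → SuperOp :=
  fun i => unitaryChannel v * G i * unitaryChannel v⁻¹

/-- Unitary 2-design: twirling any linear map `Λ` over the family gives a map
`X ↦ a X + b tr(X) 1`, that is (as `a`, `b` are fixed by the trace and by `tr Λ(1)`, which
twirling preserves), the same map as twirling `Λ` over the whole unitary group. -/
def IsTwoDesign {ι : Type*} [Fintype ι] (u : ι → Matrix.unitaryGroup (Fin 2) ℂ) : Prop :=
  ∀ Λ : SuperOp, ∃ a b : ℂ, ∀ X : Op,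
    (Fintype.card ι : ℂ)⁻¹ • ∑ i, (unitaryChannel (u i) * Λ * unitaryChannel (u i)⁻¹) X
      = a • X + (b * X.trace) • (1 : Op)

/-- The projector `X ↦ X - tr(X) 1 / d` onto the traceless operators. -/
def tracelessProj : SuperOp where
  toFun X := X - (X.trace / 2) • (1 : Op)
  map_add' X Y := by rw [Matrix.trace_add, add_div, add_smul]; abel
  map_smul' c X := by
    rw [Matrix.trace_smul, RingHom.id_apply, smul_sub, smul_smul, smul_eq_mul, mul_div_assoc]

/-- The Pauli matrices `1, X, Y, Z`. -/
def pauli : Fin 4 → Op :=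
  ![1, !![0, 1; 1, 0], !![0, -Complex.I; Complex.I, 0], !![1, 0; 0, -1]]

/-- The Liouville matrix of a linear map, in the orthonormal basis `pauli j / √2`. -/
def liouville (A : SuperOp) : Matrix (Fin 4) (Fin 4) ℂ :=
  Matrix.of fun j k => hsInner (pauli j) (A (pauli k)) / 2

/-- The twirling superchannel `𝓣 = 𝔼 [𝒢_tr ⊗ 𝒢̃]` with `𝒢_tr = 𝒢 Π_tr`. -/
def twirlingSuperchannel {ι : Type*} [Fintype ι] (Gn G : ι → SuperOp) :
    Matrix (Fin 4 × Fin 4) (Fin 4 × Fin 4) ℂ :=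
  (Fintype.card ι : ℂ)⁻¹ • ∑ i, liouville (G i * tracelessProj) ⊗ₖ liouville (Gn i)

/-- `p` is the RB decay parameter: the highest eigenvalue of the twirling superchannel, a real
number that is an eigenvalue and bounds the modulus of every eigenvalue (so it is unique). -/
def IsRBDecayParameter {ι : Type*} [Fintype ι] (Gn G : ι → SuperOp) (p : ℝ) : Prop :=
  (p : ℂ) ∈ spectrum ℂ (twirlingSuperchannel Gn G) ∧
    ∀ z ∈ spectrum ℂ (twirlingSuperchannel Gn G), ‖z‖ ≤ p

end

end QubitRB

/-! On Bloch vectors a channel acts affinely, with a real 3 × 3 linear part that is a contraction;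
unitary channels act by rotations. Averaging over pure states removes the translation, so the
fidelity to a rotation `R` is `1/2 + tr(M Rᵀ)/6` (`avgFidelity_eq`). Averaging over circuits then
gives `1/2 + tr(Sᵐ 1)/6` for the twirl `S X = 𝔼[Mᵢ X Hᵢᵀ]` (`gateSetFidelity_eq`), and the spectrum
of the twirling superchannel is, apart from zero, that of `S`.

For ideal gates the 2-design property makes `S` the projection `X ↦ (tr X / 3) 1`. For noisy gates
`S` differs from it by the square root of the infidelity (`sq_norm_twirl_sub_le`). A fixed-point
argument gives an eigenvector `A` near `1`, of trace 3, with eigenvalue `p` near 1; modulo `A` the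
map is small, so `p` dominates the spectrum (`exists_eigenvector_near_one`, `normSq_eigenvalue_le`).

Rotating the targets by `V` replaces `A` by `A Vᵀ` and keeps `p`. Choosing `V` as in the polar
decomposition makes the eigenvector symmetric (`exists_rotation_symmetric`). Write `A = 1 + a` with
`tr a = 0` in this gauge; then `tr Sᵐ(1) = 3pᵐ - tr Sᵐ(a)`, and the last term has to be `O((1-p)²)`.
Three estimates give this.

(1) Contractivity and the design property yield `p² AᵀA ≤ (‖A‖²/3) 1`, so `A` is almost a multiple
of an isometry; being symmetric and near `1`, it satisfies `a = O(1-p)`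
(`norm_eigenvector_sub_one_le`). (2) `tr S(a) = tr(N a)` with `N = 𝔼[Hᵢᵀ Mᵢ]`. Symmetry of `a`
leaves only the symmetric part `1 - Q` of `N`, where `Q` is positive with trace `O(1-p)`; hence `tr
S(a) = -tr(Q a) = O((1-p)²)`. (3) Later applications of `S` contribute at most a constant times
`δ²‖a‖`, where `δ = O(√(1-p))` is the size of `S` on traceless matrices (`abs_trace_pow_sub_le`). -/

namespace QubitRB

/-! ### Frobenius geometry of Bloch matrices and the twirl -/

section BlochMatrices

open scoped Matrix.Norms.Frobenius

/-- Real `3 × 3` matrices, acting on Bloch vectors. -/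
abbrev Mat3 : Type := Matrix (Fin 3) (Fin 3) ℝ

theorem sq_norm_eq_sum (X : Mat3) : ‖X‖ ^ 2 = ∑ i, ∑ j, X i j ^ 2 := by
  rw [Matrix.frobenius_norm_def, ← Real.sqrt_eq_rpow, Real.sq_sqrt]
  · simp
  · positivity

theorem sq_norm_eq_trace (X : Mat3) : ‖X‖ ^ 2 = (Xᵀ * X).trace := by
  rw [sq_norm_eq_sum, Finset.sum_comm]
  simp [Matrix.trace, Matrix.mul_apply, sq]

theorem abs_trace_transpose_mul_le (X Y : Mat3) : |(Xᵀ * Y).trace| ≤ ‖X‖ * ‖Y‖ := by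
  apply abs_le_of_sq_le_sq _ (by positivity)
  rw [mul_pow, sq_norm_eq_sum, sq_norm_eq_sum]
  have h := Finset.sum_mul_sq_le_sq_mul_sq (Finset.univ : Finset (Fin 3 × Fin 3))
    (fun x => X x.1 x.2) (fun x => Y x.1 x.2)
  simp only [Fintype.sum_prod_type] at h
  refine le_trans (le_of_eq ?_) h
  rw [Finset.sum_comm]
  simp [Matrix.trace, Matrix.mul_apply]

theorem sq_norm_one : ‖(1 : Mat3)‖ ^ 2 = 3 := by
  rw [sq_norm_eq_trace]; simp

theorem norm_one_le : ‖(1 : Mat3)‖ ≤ 2 := by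
  nlinarith [sq_norm_one, norm_nonneg (1 : Mat3)]

theorem abs_trace_le (X : Mat3) : |X.trace| ≤ 2 * ‖X‖ := by
  have h := abs_trace_transpose_mul_le 1 X
  rw [Matrix.transpose_one, one_mul] at h
  exact h.trans (mul_le_mul_of_nonneg_right norm_one_le (norm_nonneg _))

theorem sq_norm_sub (X Y : Mat3) :
    ‖X - Y‖ ^ 2 = ‖X‖ ^ 2 + ‖Y‖ ^ 2 - 2 * (X * Yᵀ).trace := by
  simp only [sq_norm_eq_sum, Matrix.trace, Matrix.mul_apply, Matrix.diag, Matrix.transpose_apply,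
    Matrix.sub_apply, Finset.mul_sum, ← Finset.sum_add_distrib, ← Finset.sum_sub_distrib]
  refine Finset.sum_congr rfl fun i _ => Finset.sum_congr rfl fun j _ => ?_
  ring

theorem mulVec_dotProduct_mulVec (B : Mat3) (v : Fin 3 → ℝ) :
    (B *ᵥ v) ⬝ᵥ (B *ᵥ v) = v ⬝ᵥ ((Bᵀ * B) *ᵥ v) := by
  rw [← Matrix.mulVec_mulVec, Matrix.dotProduct_mulVec v, Matrix.vecMul_transpose]

/-- `M` does not increase the length of vectors. -/
def IsContraction (M : Mat3) : Prop := ∀ v : Fin 3 → ℝ, (M *ᵥ v) ⬝ᵥ (M *ᵥ v) ≤ v ⬝ᵥ v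

theorem sq_norm_eq_sum_mulVec (X : Mat3) :
    ‖X‖ ^ 2 = ∑ j, (fun i => X i j) ⬝ᵥ (fun i => X i j) := by
  rw [sq_norm_eq_sum, Finset.sum_comm]
  simp [dotProduct, sq]

theorem IsContraction.norm_mul_le {M : Mat3} (hM : IsContraction M) (X : Mat3) :
    ‖M * X‖ ≤ ‖X‖ := by
  apply le_of_sq_le_sq _ (norm_nonneg _)
  rw [sq_norm_eq_sum_mulVec, sq_norm_eq_sum_mulVec X]
  exact Finset.sum_le_sum fun j _ => hM (fun i => X i j)

theorem IsContraction.sq_norm_le {M : Mat3} (hM : IsContraction M) : ‖M‖ ^ 2 ≤ 3 := by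
  have h := hM.norm_mul_le 1
  rw [mul_one] at h
  rw [← sq_norm_one]
  gcongr

theorem norm_mul_transpose_of_orthogonal {H : Mat3} (hH : Hᵀ * H = 1) (X : Mat3) :
    ‖X * Hᵀ‖ = ‖X‖ := by
  have h : ‖X * Hᵀ‖ ^ 2 = ‖X‖ ^ 2 := by
    rw [sq_norm_eq_trace, sq_norm_eq_trace, Matrix.transpose_mul, Matrix.transpose_transpose,
      Matrix.trace_mul_comm]
    rw [mul_assoc, ← mul_assoc Hᵀ, hH, one_mul, Matrix.trace_mul_comm]
  exact (pow_left_inj₀ (norm_nonneg _) (norm_nonneg _) two_ne_zero).1 h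

theorem sq_norm_of_orthogonal {H : Mat3} (hH : Hᵀ * H = 1) : ‖H‖ ^ 2 = 3 := by
  rw [sq_norm_eq_trace, hH]; simp

/-- Testing positivity on `eᵢ ± eⱼ` bounds every entry by the trace, and there are nine entries.
This turns a bound on a trace into a bound on a norm of the same order, without a square root. -/
theorem norm_le_of_posSemidef {Q : Mat3} (hs : Qᵀ = Q) (hQ : ∀ v, 0 ≤ v ⬝ᵥ (Q *ᵥ v)) :
    ‖Q‖ ≤ 3 * Q.trace := by
  have hs' : ∀ i j, Q i j = Q j i := fun i j => congrFun (congrFun hs j) i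
  have hd : ∀ i, 0 ≤ Q i i := fun i => by
    simpa using hQ (Pi.single i 1)
  have ht : Q.trace = Q 0 0 + Q 1 1 + Q 2 2 := by simp [Matrix.trace, Fin.sum_univ_three]
  have h0 : ∀ i j, |Q i j| ≤ Q.trace := by
    intro i j
    have hp := hQ (Pi.single i 1 + Pi.single j 1)
    have hm := hQ (Pi.single i 1 - Pi.single j 1)
    simp [Matrix.mulVec_add, Matrix.mulVec_sub, add_dotProduct, sub_dotProduct] at hp hm
    have hij := hs' i j
    have hdi : Q i i ≤ Q.trace := by
      rw [ht]; fin_cases i <;> simp <;> linarith [hd 0, hd 1, hd 2]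
    have hdj : Q j j ≤ Q.trace := by
      rw [ht]; fin_cases j <;> simp <;> linarith [hd 0, hd 1, hd 2]
    rw [abs_le]; constructor <;> linarith
  have htr : 0 ≤ Q.trace := by rw [ht]; linarith [hd 0, hd 1, hd 2]
  apply le_of_sq_le_sq _ (by positivity)
  rw [sq_norm_eq_sum]
  calc ∑ i, ∑ j, Q i j ^ 2 ≤ ∑ _i : Fin 3, ∑ _j : Fin 3, Q.trace ^ 2 :=
        Finset.sum_le_sum fun i _ => Finset.sum_le_sum fun j _ => sq_le_sq'
          (abs_le.1 (h0 i j)).1 (abs_le.1 (h0 i j)).2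
    _ = (3 * Q.trace) ^ 2 := by simp; ring

variable {ι : Type*} [Fintype ι]

/-- The map `X ↦ 𝔼 [Mᵢ X Hᵢᵀ]`. -/
noncomputable def twirl (M H : ι → Mat3) : Mat3 →ₗ[ℝ] Mat3 where
  toFun X := (Fintype.card ι : ℝ)⁻¹ • ∑ i, M i * X * (H i)ᵀ
  map_add' X Y := by simp [mul_add, add_mul, Finset.sum_add_distrib]
  map_smul' c X := by simp [← Finset.smul_sum, smul_comm c]

theorem twirl_apply (M H : ι → Mat3) (X : Mat3) :
    twirl M H X = (Fintype.card ι : ℝ)⁻¹ • ∑ i, M i * X * (H i)ᵀ := rfl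

/-- The family `H` consists of orthogonal matrices, and averaging `X ↦ Hᵢ X Hᵢᵀ` projects onto
the multiples of the identity. -/
structure IsOrthogonalTwirl (H : ι → Mat3) : Prop where
  orthogonal : ∀ i, (H i)ᵀ * H i = 1
  twirl_self : ∀ X, twirl H H X = (X.trace / 3) • (1 : Mat3)

theorem trace_twirl_one (M H : ι → Mat3) :
    (twirl M H 1).trace = (Fintype.card ι : ℝ)⁻¹ * ∑ i, (M i * (H i)ᵀ).trace := by
  simp [twirl_apply, Matrix.trace_sum]

variable [Nonempty ι]

theorem cast_card_pos : (0 : ℝ) < Fintype.card ι := by exact_mod_cast Fintype.card_pos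

theorem sq_inv_card_mul_sum_le (f : ι → ℝ) :
    ((Fintype.card ι : ℝ)⁻¹ * ∑ i, f i) ^ 2 ≤ (Fintype.card ι : ℝ)⁻¹ * ∑ i, f i ^ 2 := by
  have h := sq_sum_le_card_mul_sum_sq (s := (Finset.univ : Finset ι)) (f := f)
  have hc := cast_card_pos (ι := ι)
  rw [Finset.card_univ] at h
  rw [mul_pow, inv_pow, inv_mul_le_iff₀ (by positivity)]
  calc _ ≤ _ := h
    _ = _ := by field_simp

theorem inv_card_mul_sum_le {f : ι → ℝ} {c : ℝ} (h : ∀ i, f i ≤ c) :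
    (Fintype.card ι : ℝ)⁻¹ * ∑ i, f i ≤ c := by
  have hc := cast_card_pos (ι := ι)
  rw [inv_mul_le_iff₀ hc]
  calc _ ≤ ∑ _i : ι, c := Finset.sum_le_sum fun i _ => h i
    _ = _ := by simp

theorem norm_twirl_le {M H : ι → Mat3} (hM : ∀ i, IsContraction (M i))
    (hH : ∀ i, (H i)ᵀ * H i = 1) (X : Mat3) : ‖twirl M H X‖ ≤ ‖X‖ := by
  rw [twirl_apply, norm_smul, norm_inv, Real.norm_natCast]
  refine (mul_le_mul_of_nonneg_left (norm_sum_le _ _) (by positivity)).trans ?_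
  apply inv_card_mul_sum_le
  intro i
  rw [norm_mul_transpose_of_orthogonal (hH i)]
  exact (hM i).norm_mul_le X

/-- The deviation of `twirl M H` from the ideal projection is controlled by the infidelity. -/
theorem sq_norm_twirl_sub_le {M H : ι → Mat3} (hM : ∀ i, IsContraction (M i))
    (hH : IsOrthogonalTwirl H) (X : Mat3) :
    ‖twirl M H X - (X.trace / 3) • (1 : Mat3)‖ ^ 2
      ≤ (6 - 2 * (twirl M H 1).trace) * ‖X‖ ^ 2 := by
  have h1 : twirl M H X - (X.trace / 3) • (1 : Mat3)
      = (Fintype.card ι : ℝ)⁻¹ • ∑ i, (M i - H i) * X * (H i)ᵀ := by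
    rw [← hH.twirl_self, twirl_apply, twirl_apply, ← smul_sub, ← Finset.sum_sub_distrib]
    simp [sub_mul]
  have h2 : ‖twirl M H X - (X.trace / 3) • (1 : Mat3)‖
      ≤ (Fintype.card ι : ℝ)⁻¹ * ∑ i, ‖M i - H i‖ * ‖X‖ := by
    rw [h1, norm_smul, norm_inv, Real.norm_natCast]
    refine mul_le_mul_of_nonneg_left ((norm_sum_le _ _).trans ?_) (by positivity)
    refine Finset.sum_le_sum fun i _ => ?_
    rw [norm_mul_transpose_of_orthogonal (hH.orthogonal i)]
    exact norm_mul_le _ _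
  -- Both `Mᵢ` and `Hᵢ` have squared norm at most 3, so `‖Mᵢ - Hᵢ‖² ≤ 6 - 2 tr(Mᵢ Hᵢᵀ)`.
  have h3 : (Fintype.card ι : ℝ)⁻¹ * ∑ i, ‖M i - H i‖ ^ 2 ≤ 6 - 2 * (twirl M H 1).trace := by
    rw [trace_twirl_one]
    have hc := cast_card_pos (ι := ι)
    have : ∑ i, ‖M i - H i‖ ^ 2 ≤ ∑ i, (6 - 2 * (M i * (H i)ᵀ).trace) := by
      refine Finset.sum_le_sum fun i _ => ?_
      rw [sq_norm_sub, sq_norm_of_orthogonal (hH.orthogonal i)]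
      linarith [(hM i).sq_norm_le]
    refine (mul_le_mul_of_nonneg_left this (by positivity)).trans (le_of_eq ?_)
    rw [Finset.sum_sub_distrib, ← Finset.mul_sum]
    simp
    field_simp
  calc _ ≤ ((Fintype.card ι : ℝ)⁻¹ * ∑ i, ‖M i - H i‖ * ‖X‖) ^ 2 := by gcongr
    _ = ((Fintype.card ι : ℝ)⁻¹ * ∑ i, ‖M i - H i‖) ^ 2 * ‖X‖ ^ 2 := by
        rw [← Finset.sum_mul]; ring
    _ ≤ _ := by
        gcongr
        exact (sq_inv_card_mul_sum_le _).trans h3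

/-- Singular values of an eigenvector are bounded by their quadratic mean. -/
theorem sq_mul_dotProduct_mulVec_le {M H : ι → Mat3} (hM : ∀ i, IsContraction (M i))
    (hH : IsOrthogonalTwirl H) {A : Mat3} {p : ℝ} (hA : twirl M H A = p • A) (v : Fin 3 → ℝ) :
    p ^ 2 * ((A *ᵥ v) ⬝ᵥ (A *ᵥ v)) ≤ ‖A‖ ^ 2 / 3 * (v ⬝ᵥ v) := by
  have hc := cast_card_pos (ι := ι)
  have h1 : p • (A *ᵥ v) = (Fintype.card ι : ℝ)⁻¹ • ∑ i, (M i * A * (H i)ᵀ) *ᵥ v := by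
    rw [← Matrix.smul_mulVec, ← hA, twirl_apply, Matrix.smul_mulVec, Matrix.sum_mulVec]
  have h2 : p ^ 2 * ((A *ᵥ v) ⬝ᵥ (A *ᵥ v)) = (p • (A *ᵥ v)) ⬝ᵥ (p • (A *ᵥ v)) := by
    simp; ring
  -- The square of a mean is at most the mean of the squares. Contractivity then removes each `Mᵢ`,
  -- and what remains is the ideal twirl of `AᵀA`, which is `(‖A‖²/3) 1`.
  have h3 : (p • (A *ᵥ v)) ⬝ᵥ (p • (A *ᵥ v)) ≤
      (Fintype.card ι : ℝ)⁻¹ * ∑ i, ((M i * A * (H i)ᵀ) *ᵥ v) ⬝ᵥ ((M i * A * (H i)ᵀ) *ᵥ v) := by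
    rw [h1]
    simp only [dotProduct, ← sq]
    rw [Finset.sum_comm, Finset.mul_sum]
    refine Finset.sum_le_sum fun j _ => ?_
    simpa using sq_inv_card_mul_sum_le (fun i => ((M i * A * (H i)ᵀ) *ᵥ v) j)
  have h4 : ∀ i, ((M i * A * (H i)ᵀ) *ᵥ v) ⬝ᵥ ((M i * A * (H i)ᵀ) *ᵥ v)
      ≤ v ⬝ᵥ ((H i * (Aᵀ * A) * (H i)ᵀ) *ᵥ v) := by
    intro i
    have h5 := hM i ((A * (H i)ᵀ) *ᵥ v)
    rw [Matrix.mulVec_mulVec, ← mul_assoc] at h5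
    refine h5.trans (le_of_eq ?_)
    rw [show H i * (Aᵀ * A) * (H i)ᵀ = (A * (H i)ᵀ)ᵀ * (A * (H i)ᵀ) by
      simp [Matrix.transpose_mul, mul_assoc], mulVec_dotProduct_mulVec]
  rw [h2]
  refine h3.trans ?_
  refine (mul_le_mul_of_nonneg_left (Finset.sum_le_sum fun i _ => h4 i) (by positivity)).trans
    (le_of_eq ?_)
  have h6 := hH.twirl_self (Aᵀ * A)
  rw [← sq_norm_eq_trace, twirl_apply] at h6
  rw [← dotProduct_sum, ← Matrix.sum_mulVec, ← smul_eq_mul, ← dotProduct_smul,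
    ← Matrix.smul_mulVec, h6]
  simp [Matrix.smul_mulVec]

end BlochMatrices

/-! ### Perturbation of the rank-one projection -/

section Perturbation

open scoped Matrix.Norms.Frobenius

/-- A linear map close to `X ↦ (tr X / 3) 1` has an eigenvector near `1`, with eigenvalue
near `1`. -/
theorem exists_eigenvector_near_one {S : Mat3 →ₗ[ℝ] Mat3} {δ : ℝ} (hδ : δ ≤ 1 / 100)
    (hS : ∀ X, ‖S X - (X.trace / 3) • (1 : Mat3)‖ ≤ δ * ‖X‖) :
    ∃ (p : ℝ) (A : Mat3), S A = p • A ∧ A.trace = 3 ∧ ‖A - 1‖ ≤ 1 / 10 ∧ |1 - p| ≤ 2 * δ := by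
  have hδ0 : 0 ≤ δ := by
    have h := (norm_nonneg _).trans (hS 1)
    have : 0 < ‖(1 : Mat3)‖ := norm_pos_iff.2 one_ne_zero
    by_contra hneg
    nlinarith
  obtain ⟨D, hD⟩ : ∃ D : Mat3 →ₗ[ℝ] Mat3, ∀ X, S X = D X + (X.trace / 3) • (1 : Mat3) :=
    ⟨S - ((Matrix.traceLinearMap (Fin 3) ℝ ℝ).smulRight ((1 / 3 : ℝ) • (1 : Mat3))), fun X => by
      simp [smul_smul, div_eq_mul_inv]⟩
  have hDn : ∀ X, ‖D X‖ ≤ δ * ‖X‖ := fun X => by simpa [hD] using hS X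
  have hτ : ∀ X, |(D X).trace / 3| ≤ δ * ‖X‖ := fun X => by
    rw [abs_div, abs_of_pos (by norm_num : (0 : ℝ) < 3)]
    linarith [abs_trace_le (D X), hDn X, norm_nonneg (D X)]
  have hball : ∀ a : Mat3, ‖a‖ ≤ 1 / 10 → ‖1 + a‖ ≤ 2 := fun a ha => by
    have h1 : ‖(1 : Mat3)‖ ≤ 1.8 := by nlinarith [sq_norm_one, norm_nonneg (1 : Mat3)]
    linarith [norm_add_le 1 a]
  -- For `A = 1 + a` with `tr a = 0`, the trace of `S A = p A` forces `p = 1 + tr D(1 + a)/3`.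
  -- Substituting this value turns the eigenvector equation into the fixed-point equation `Ψ a = a`.
  let Ψ : Mat3 → Mat3 := fun a => D (1 + a) - ((D (1 + a)).trace / 3) • (1 + a)
  have hmaps : Set.MapsTo Ψ (Metric.closedBall 0 (1 / 10)) (Metric.closedBall 0 (1 / 10)) := by
    intro a ha
    rw [mem_closedBall_zero_iff] at ha ⊢
    have h2 := hball a ha
    calc ‖Ψ a‖ ≤ ‖D (1 + a)‖ + ‖((D (1 + a)).trace / 3) • (1 + a)‖ := norm_sub_le _ _
      _ ≤ δ * ‖1 + a‖ + δ * ‖1 + a‖ * ‖1 + a‖ := by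
        rw [norm_smul]
        gcongr
        · exact hDn _
        · exact hτ _
      _ ≤ δ * 2 + δ * 2 * 2 := by gcongr
      _ ≤ 1 / 10 := by linarith
  have hdist : ∀ a b : Mat3, ‖a‖ ≤ 1 / 10 → ‖b‖ ≤ 1 / 10 → ‖Ψ a - Ψ b‖ ≤ 1 / 2 * ‖a - b‖ := by
    intro a b ha hb
    have h2 := hball a ha
    have h3 := hball b hb
    have hDab : D (1 + a) - D (1 + b) = D (a - b) := by rw [← map_sub]; congr 1; abel
    have hΨ : Ψ a - Ψ b = D (a - b) - ((D (a - b)).trace / 3) • (1 + a)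
        - ((D (1 + b)).trace / 3) • (a - b) := by
      simp only [Ψ]
      rw [← hDab, Matrix.trace_sub]
      module
    rw [hΨ]
    calc _ ≤ ‖D (a - b)‖ + ‖((D (a - b)).trace / 3) • (1 + a)‖
          + ‖((D (1 + b)).trace / 3) • (a - b)‖ :=
          (norm_sub_le _ _).trans (add_le_add (norm_sub_le _ _) le_rfl)
      _ ≤ δ * ‖a - b‖ + δ * ‖a - b‖ * 2 + δ * ‖1 + b‖ * ‖a - b‖ := by
        rw [norm_smul, norm_smul]
        gcongr
        · exact hDn _
        · exact hτ _
        · exact hτ _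
      _ ≤ δ * ‖a - b‖ + δ * ‖a - b‖ * 2 + δ * 2 * ‖a - b‖ := by gcongr
      _ ≤ 1 / 2 * ‖a - b‖ := by nlinarith [norm_nonneg (a - b)]
  have hcontr : ContractingWith (1 / 2) (hmaps.restrict Ψ _ _) := by
    refine ⟨by rw [← NNReal.coe_lt_coe]; norm_num, LipschitzWith.of_dist_le_mul fun a b => ?_⟩
    have ha := mem_closedBall_zero_iff.1 a.2
    have hb := mem_closedBall_zero_iff.1 b.2
    rw [Subtype.dist_eq, Subtype.dist_eq, dist_eq_norm, dist_eq_norm]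
    simpa using hdist a b ha hb
  obtain ⟨a, ha, hfix, -⟩ := hcontr.exists_fixedPoint'
    Metric.isClosed_closedBall.isComplete hmaps (x := 0) (by simp) (edist_ne_top _ _)
  rw [mem_closedBall_zero_iff] at ha
  have hfix' : D (1 + a) - ((D (1 + a)).trace / 3) • (1 + a) = a := hfix
  set t := (D (1 + a)).trace / 3 with ht
  have htle : |t| ≤ 2 * δ := (hτ _).trans (by nlinarith [hball a ha])
  -- The ball does not impose zero trace. Taking traces in the fixed-point equation gives `tr a · (1
  -- + t) = 0`, and `t` is small.
  have htra : a.trace = 0 := by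
    have h := congrArg Matrix.trace hfix'
    rw [Matrix.trace_sub, Matrix.trace_smul, Matrix.trace_add, Matrix.trace_one,
      show (D (1 + a)).trace = 3 * t by rw [ht]; ring] at h
    simp at h
    have h4 : a.trace * (1 + t) = 0 := by linarith
    rcases mul_eq_zero.1 h4 with h5 | h5
    · exact h5
    · linarith [(abs_le.1 htle).1]
  have htr : (1 + a).trace = 3 := by rw [Matrix.trace_add, htra]; simp
  refine ⟨1 + t, 1 + a, ?_, htr, by simpa using ha, by simpa using htle⟩
  rw [hD, htr, sub_eq_iff_eq_add.1 hfix']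
  module

variable {S : Mat3 →ₗ[ℝ] Mat3} {δ p : ℝ} {A : Mat3}

/-- A linear map close to `X ↦ (tr X / 3) 1` is small on the quotient by its leading
eigenvector. -/
theorem norm_sub_trace_smul_le (hS : ∀ X, X.trace = 0 → ‖S X‖ ≤ δ * ‖X‖)
    (hA : ‖A‖ ≤ 2) {y : Mat3} (hy : y.trace = 0) :
    ‖S y - ((S y).trace / 3) • A‖ ≤ 3 * δ * ‖y‖ := by
  have h := abs_trace_le (S y)
  calc _ ≤ ‖S y‖ + ‖((S y).trace / 3) • A‖ := norm_sub_le _ _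
    _ = ‖S y‖ + |(S y).trace| / 3 * ‖A‖ := by
      rw [norm_smul, Real.norm_eq_abs, abs_div, abs_of_pos (by norm_num : (0 : ℝ) < 3)]
    _ ≤ ‖S y‖ + (2 * ‖S y‖) / 3 * 2 := by gcongr
    _ ≤ 3 * ‖S y‖ := by linarith [norm_nonneg (S y)]
    _ ≤ 3 * (δ * ‖y‖) := by gcongr; exact hS y hy
    _ = _ := by ring

/-- This is `|zW|² = |z|²|W|²` for `z = a + b i` and `W = X + i Y`, in real coordinates. -/
theorem sq_norm_smul_add_smul (a b : ℝ) (X Y : Mat3) :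
    ‖a • X - b • Y‖ ^ 2 + ‖b • X + a • Y‖ ^ 2 = (a ^ 2 + b ^ 2) * (‖X‖ ^ 2 + ‖Y‖ ^ 2) := by
  simp only [sq_norm_eq_sum, ← Finset.sum_add_distrib, Finset.mul_sum]
  refine Finset.sum_congr rfl fun i _ => Finset.sum_congr rfl fun j _ => ?_
  simp
  ring

/-- The eigenvalue of the leading eigenvector dominates all complex eigenvalues `a + b i`. -/
theorem normSq_eigenvalue_le (hS : ∀ X, X.trace = 0 → ‖S X‖ ≤ δ * ‖X‖) (hδ : 0 ≤ δ)
    (hδp : 3 * δ ≤ p) (hA : ‖A‖ ≤ 2) (hAtr : A.trace = 3) (hSA : S A = p • A)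
    {a b : ℝ} {X Y : Mat3} (hX : S X = a • X - b • Y) (hY : S Y = b • X + a • Y)
    (hne : X ≠ 0 ∨ Y ≠ 0) : a ^ 2 + b ^ 2 ≤ p ^ 2 := by
  obtain ⟨x, hx⟩ : ∃ x, x = X.trace / 3 := ⟨_, rfl⟩
  obtain ⟨y, hy⟩ : ∃ y, y = Y.trace / 3 := ⟨_, rfl⟩
  obtain ⟨X', hX'⟩ : ∃ X', X' = X - x • A := ⟨_, rfl⟩
  obtain ⟨Y', hY'⟩ : ∃ Y', Y' = Y - y • A := ⟨_, rfl⟩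
  have htX : X'.trace = 0 := by rw [hX', Matrix.trace_sub, Matrix.trace_smul, hAtr, hx]; simp
  have htY : Y'.trace = 0 := by rw [hY', Matrix.trace_sub, Matrix.trace_smul, hAtr, hy]; simp
  have hSX : S X' = a • X' - b • Y' + (a * x - b * y - p * x) • A := by
    rw [hX', hY', map_sub, map_smul, hX, hSA]; module
  have hSY : S Y' = b • X' + a • Y' + (b * x + a * y - p * y) • A := by
    rw [hX', hY', map_sub, map_smul, hY, hSA]; module
  have htSX : (S X').trace / 3 = a * x - b * y - p * x := by
    rw [hSX]; simp [Matrix.trace_add, Matrix.trace_sub, htX, htY, hAtr]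
  have htSY : (S Y').trace / 3 = b * x + a * y - p * y := by
    rw [hSY]; simp [Matrix.trace_add, htX, htY, hAtr]
  have h1 := norm_sub_trace_smul_le hS hA htX
  have h2 := norm_sub_trace_smul_le hS hA htY
  rw [htSX, hSX, add_sub_cancel_right] at h1
  rw [htSY, hSY, add_sub_cancel_right] at h2
  have h3 := sq_norm_smul_add_smul a b X' Y'
  have h4 : (a ^ 2 + b ^ 2) * (‖X'‖ ^ 2 + ‖Y'‖ ^ 2) ≤ p ^ 2 * (‖X'‖ ^ 2 + ‖Y'‖ ^ 2) := by
    rw [← h3]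
    calc _ ≤ (3 * δ * ‖X'‖) ^ 2 + (3 * δ * ‖Y'‖) ^ 2 := by gcongr
      _ ≤ (p * ‖X'‖) ^ 2 + (p * ‖Y'‖) ^ 2 := by gcongr
      _ = _ := by ring
  -- If both remainders vanish, the eigenvector lies in the complex span of `A` and the eigenvalue
  -- is `p` in modulus. Otherwise the induced map modulo `A`, of norm at most `3δ ≤ p`, has it as an
  -- eigenvalue.
  by_cases h0 : X' = 0 ∧ Y' = 0
  · obtain ⟨hX0, hY0⟩ := h0
    rw [hX0, map_zero, Matrix.trace_zero, zero_div] at htSX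
    rw [hY0, map_zero, Matrix.trace_zero, zero_div] at htSY
    have hxy : 0 < x ^ 2 + y ^ 2 := by
      by_contra hneg
      have hx0 : x = 0 := by nlinarith [sq_nonneg x, sq_nonneg y]
      have hy0 : y = 0 := by nlinarith [sq_nonneg x, sq_nonneg y]
      rw [hx0, zero_smul, sub_zero] at hX'
      rw [hy0, zero_smul, sub_zero] at hY'
      rcases hne with h | h
      · exact h (hX' ▸ hX0)
      · exact h (hY' ▸ hY0)
    have h5 : (a ^ 2 + b ^ 2) * (x ^ 2 + y ^ 2) = p ^ 2 * (x ^ 2 + y ^ 2) := by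
      have e1 : p * x = a * x - b * y := by linarith
      have e2 : p * y = b * x + a * y := by linarith
      calc _ = (a * x - b * y) ^ 2 + (b * x + a * y) ^ 2 := by ring
        _ = (p * x) ^ 2 + (p * y) ^ 2 := by rw [e1, e2]
        _ = _ := by ring
    exact (mul_right_cancel₀ hxy.ne' h5).le
  · have h6 : 0 < ‖X'‖ ^ 2 + ‖Y'‖ ^ 2 := by
      by_contra hneg
      apply h0
      constructor <;> apply norm_eq_zero.1 <;> nlinarith [norm_nonneg X', norm_nonneg Y']
    exact le_of_mul_le_mul_right h4 h6

/-- If the leading eigenvector deviates from the identity by `a`, and `tr S(a)` is small, then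
`tr Sᵐ(1)` stays close to `3 pᵐ`. -/
theorem abs_trace_pow_sub_le (hS : ∀ X, X.trace = 0 → ‖S X‖ ≤ δ * ‖X‖) (hδ0 : 0 ≤ δ)
    (hδ : 3 * δ ≤ 1 / 2) (hA : ‖A‖ ≤ 2) (hAtr : A.trace = 3) (hSA : S A = p • A)
    (hp0 : 0 ≤ p) (hp1 : p ≤ 1) (m : ℕ) :
    |((S ^ m) 1).trace / 3 - p ^ m|
      ≤ |(S (A - 1)).trace / 3| + (3 * δ) ^ 2 * ‖A - 1‖ := by
  obtain ⟨κ, hκ⟩ : ∃ κ, κ = 3 * δ := ⟨_, rfl⟩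
  have hκ0 : 0 ≤ κ := by rw [hκ]; positivity
  rw [← hκ] at hδ ⊢
  have hatr : (A - 1).trace = 0 := by rw [Matrix.trace_sub, hAtr]; simp
  have hSA' : ∀ m, (S ^ m) A = p ^ m • A := by
    intro m
    induction m with
    | zero => simp
    | succ m ih => rw [pow_succ', Module.End.mul_apply, ih, map_smul, hSA, smul_smul, pow_succ]
  -- The first step is kept as `tr S(A - 1)`: the generic bound `δ‖A - 1‖` would only be of order
  -- `(1-p)^(3/2)`. Later increments of `c` are geometric, starting at order `κ²`; the subtracted `κ
  -- ^ (m + 2)` lets them telescope, since `κ ≤ 1/2`.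
  have key : ∀ m : ℕ, ∃ (c : ℝ) (y : Mat3), (S ^ (m + 1)) (A - 1) = c • A + y ∧ y.trace = 0 ∧
      ‖y‖ ≤ κ ^ (m + 1) * ‖A - 1‖ ∧
      |c| ≤ |(S (A - 1)).trace / 3| + κ ^ 2 * ‖A - 1‖ - κ ^ (m + 2) * ‖A - 1‖ := by
    intro m
    induction m with
    | zero =>
      refine ⟨(S (A - 1)).trace / 3, S (A - 1) - ((S (A - 1)).trace / 3) • A, by simp, ?_, ?_,
        by simp⟩
      · rw [Matrix.trace_sub, Matrix.trace_smul, hAtr]; simp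
      · rw [zero_add, pow_one, hκ]
        exact norm_sub_trace_smul_le hS hA hatr
    | succ m ih =>
      obtain ⟨c, y, hcy, hy, hyn, hc⟩ := ih
      refine ⟨p * c + (S y).trace / 3, S y - ((S y).trace / 3) • A, ?_, ?_, ?_, ?_⟩
      · rw [pow_succ', Module.End.mul_apply, hcy, map_add, map_smul, hSA]; module
      · rw [Matrix.trace_sub, Matrix.trace_smul, hAtr]; simp
      · refine (norm_sub_trace_smul_le hS hA hy).trans ?_
        rw [← hκ, pow_succ', mul_assoc]
        gcongr
      · have h1 : |(S y).trace / 3| ≤ κ ^ (m + 2) * ‖A - 1‖ / 3 := by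
          rw [abs_div, abs_of_pos (by norm_num : (0 : ℝ) < 3)]
          gcongr
          calc |(S y).trace| ≤ 2 * (δ * ‖y‖) := (abs_trace_le _).trans (by gcongr; exact hS y hy)
            _ ≤ κ * ‖y‖ := by rw [hκ]; nlinarith [mul_nonneg hδ0 (norm_nonneg y)]
            _ ≤ κ * (κ ^ (m + 1) * ‖A - 1‖) := by gcongr
            _ = _ := by ring
        have h2 : |p * c| ≤ |c| := by
          rw [abs_mul, abs_of_nonneg hp0]
          exact mul_le_of_le_one_left (abs_nonneg _) hp1
        have h3 : κ ^ (m + 1 + 2) * ‖A - 1‖ ≤ 1 / 2 * (κ ^ (m + 2) * ‖A - 1‖) := by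
          rw [pow_succ', mul_assoc]; gcongr
        have h4 : 0 ≤ κ ^ (m + 2) * ‖A - 1‖ := by positivity
        linarith [abs_add_le (p * c) ((S y).trace / 3)]
  have hone : ∀ m, ((S ^ m) 1).trace / 3 - p ^ m = -(((S ^ m) (A - 1)).trace / 3) := by
    intro m
    have h : (S ^ m) (A - 1) = p ^ m • A - (S ^ m) 1 := by rw [map_sub, hSA']
    rw [h, Matrix.trace_sub, Matrix.trace_smul, hAtr]
    simp; ring
  rw [hone, abs_neg]
  cases m with
  | zero =>
    rw [pow_zero, Module.End.one_apply, hatr]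
    simp; positivity
  | succ m =>
    obtain ⟨c, y, hcy, hy, -, hc⟩ := key m
    have : ((S ^ (m + 1)) (A - 1)).trace / 3 = c := by
      rw [hcy, Matrix.trace_add, Matrix.trace_smul, hAtr, hy]; simp
    rw [this]
    have h4 : 0 ≤ κ ^ (m + 2) * ‖A - 1‖ := by positivity
    linarith

end Perturbation

/-! ### Quadratic error in the symmetric gauge -/

section Gauge

open scoped Matrix.Norms.Frobenius

variable {ι : Type*} [Fintype ι] [Nonempty ι] {M H : ι → Mat3} {p : ℝ} {A : Mat3}

theorem dotProduct_transpose_mulVec_self (B : Mat3) (v : Fin 3 → ℝ) :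
    v ⬝ᵥ (Bᵀ *ᵥ v) = v ⬝ᵥ (B *ᵥ v) := by
  rw [Matrix.mulVec_transpose, dotProduct_comm, ← Matrix.dotProduct_mulVec]

/-- The twirl averages norm-nonincreasing maps, so no real eigenvalue exceeds 1. -/
theorem decay_le_one (hM : ∀ i, IsContraction (M i)) (hH : IsOrthogonalTwirl H)
    (hA : twirl M H A = p • A) (hA0 : A ≠ 0) : p ≤ 1 := by
  have h1 : ‖p • A‖ ≤ ‖A‖ := hA ▸ norm_twirl_le hM hH.orthogonal A
  rw [norm_smul] at h1
  have h2 : 0 < ‖A‖ := norm_pos_iff.2 hA0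
  have h3 : ‖p‖ ≤ 1 := by
    by_contra h
    push Not at h
    nlinarith
  exact (le_abs_self p).trans h3

/-- A symmetric leading eigenvector is close to the identity, to first order in `1 - p`. -/
theorem norm_eigenvector_sub_one_le (hM : ∀ i, IsContraction (M i)) (hH : IsOrthogonalTwirl H)
    (hA : twirl M H A = p • A) (hAtr : A.trace = 3) (hAs : Aᵀ = A) (hA1 : ‖A - 1‖ ≤ 1 / 2)
    (hp1 : p ≤ 1) (hp : 9 / 10 ≤ p) : ‖A - 1‖ ≤ 30 * (1 - p) := by
  obtain ⟨a, ha⟩ : ∃ a, a = A - 1 := ⟨_, rfl⟩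
  have hAa : A = 1 + a := by rw [ha]; abel
  rw [← ha] at hA1 ⊢
  have hatr : a.trace = 0 := by rw [ha, Matrix.trace_sub, hAtr]; simp
  have hnA : ‖A‖ ^ 2 = 3 + ‖a‖ ^ 2 := by
    have h := sq_norm_sub A 1
    rw [← ha, sq_norm_one, Matrix.transpose_one, mul_one, hAtr] at h
    linarith
  obtain ⟨Z, hZ⟩ : ∃ Z : Mat3, Z = (‖A‖ ^ 2 / 3) • 1 - p ^ 2 • (Aᵀ * A) := ⟨_, rfl⟩
  have hZs : Zᵀ = Z := by rw [hZ]; simp [Matrix.transpose_mul]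
  -- `Z` measures how far `A` is from a multiple of an isometry. It is positive with trace `O(1-p)`,
  -- hence of norm `O(1-p)`.
  have hZpos : ∀ v, 0 ≤ v ⬝ᵥ (Z *ᵥ v) := by
    intro v
    have h := sq_mul_dotProduct_mulVec_le hM hH hA v
    rw [mulVec_dotProduct_mulVec] at h
    rw [hZ, Matrix.sub_mulVec, Matrix.smul_mulVec, Matrix.smul_mulVec, dotProduct_sub,
      dotProduct_smul, dotProduct_smul, Matrix.one_mulVec]
    simpa using h
  have hZtr : Z.trace = ‖A‖ ^ 2 * (1 - p ^ 2) := by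
    rw [hZ, Matrix.trace_sub, Matrix.trace_smul, Matrix.trace_smul, ← sq_norm_eq_trace]
    simp; ring
  have hZn := norm_le_of_posSemidef hZs hZpos
  rw [hZtr] at hZn
  -- Symmetry enters here: `AᵀA = 1 + 2a + a²`, so `Z` determines `a` up to quadratic terms, which
  -- are absorbed on the left because `‖a‖ ≤ 1/2`.
  have hid : (2 * p ^ 2) • a
      = (‖A‖ ^ 2 / 3 * (1 - p ^ 2)) • (1 : Mat3) - Z - p ^ 2 • (a * a - (‖a‖ ^ 2 / 3) • 1) := by
    rw [hZ, hAs, hnA, hAa]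
    simp only [mul_add, add_mul, one_mul, mul_one]
    module
  have hq : 0 ≤ 1 - p ^ 2 := by nlinarith
  have h1 : 2 * p ^ 2 * ‖a‖ ≤ ‖A‖ ^ 2 / 3 * (1 - p ^ 2) * 2 + 3 * (‖A‖ ^ 2 * (1 - p ^ 2))
      + p ^ 2 * (‖a‖ * ‖a‖ + ‖a‖ ^ 2 / 3 * 2) := by
    have hn := congrArg norm hid
    rw [norm_smul, Real.norm_of_nonneg (by positivity)] at hn
    rw [hn]
    refine (norm_sub_le _ _).trans (add_le_add ((norm_sub_le _ _).trans (add_le_add ?_ hZn)) ?_)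
    · rw [norm_smul, Real.norm_of_nonneg (by positivity)]
      gcongr
      exact norm_one_le
    · rw [norm_smul, Real.norm_of_nonneg (by positivity)]
      gcongr
      refine (norm_sub_le _ _).trans (add_le_add (norm_mul_le _ _) ?_)
      rw [norm_smul, Real.norm_of_nonneg (by positivity)]
      gcongr
      exact norm_one_le
  have h0 := norm_nonneg a
  have h2 : ‖a‖ ^ 2 ≤ 1 / 2 * ‖a‖ := by nlinarith
  have h3 : ‖A‖ ^ 2 ≤ 13 / 4 := by nlinarith
  have h4 : ‖A‖ ^ 2 * (1 - p ^ 2) ≤ 13 / 4 * (1 - p ^ 2) := by gcongr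
  have h5 : 1 - p ^ 2 ≤ 2 * (1 - p) := by nlinarith
  have h6 : p ^ 2 * (‖a‖ * ‖a‖ + ‖a‖ ^ 2 / 3 * 2) ≤ p ^ 2 * (5 / 6 * ‖a‖) := by
    gcongr; nlinarith
  have h7 : (81 / 100) * ‖a‖ ≤ p ^ 2 * ‖a‖ := by gcongr; nlinarith
  linarith

/-- Decay of the circuit fidelities, in the gauge where the leading eigenvector of the twirl is
symmetric. -/
theorem abs_trace_twirl_pow_sub_le (hM : ∀ i, IsContraction (M i)) (hH : IsOrthogonalTwirl H)
    (hA : twirl M H A = p • A) (hAtr : A.trace = 3) (hAs : Aᵀ = A) (hA1 : ‖A - 1‖ ≤ 1 / 4)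
    (hp1 : p ≤ 1) (hp : 1 - p ≤ 1 / 5000) (m : ℕ) :
    |((twirl M H ^ m) 1).trace / 3 - p ^ m| ≤ 50000 * (1 - p) ^ 2 := by
  have hq : 0 ≤ 1 - p := by linarith
  have ha := norm_eigenvector_sub_one_le hM hH hA hAtr hAs (hA1.trans (by norm_num)) hp1
    (by linarith)
  have ha0 := norm_nonneg (A - 1)
  have hatr : (A - 1).trace = 0 := by rw [Matrix.trace_sub, hAtr]; simp
  have has : (A - 1)ᵀ = A - 1 := by rw [Matrix.transpose_sub, hAs, Matrix.transpose_one]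
  have hA2 : ‖A‖ ≤ 2 := by
    have h := sq_norm_sub A 1
    rw [sq_norm_one, Matrix.transpose_one, mul_one, hAtr] at h
    nlinarith [norm_nonneg A]
  have hS1 : 3 - (twirl M H 1).trace ≤ 63 * (1 - p) := by
    have h : twirl M H 1 = p • A - twirl M H (A - 1) := by rw [map_sub, hA]; abel
    rw [h, Matrix.trace_sub, Matrix.trace_smul, hAtr, smul_eq_mul]
    have h1 := (abs_le.1 (abs_trace_le (twirl M H (A - 1)))).2
    have h2 := norm_twirl_le hM hH.orthogonal (A - 1)
    linarith
  -- `126 = 2 · 63` comes from `‖S X‖² ≤ (6 - 2 tr S(1)) ‖X‖²` on traceless `X`. With `1 - p ≤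
  -- 1/5000` it gives `3δ ≤ 1/2`.
  obtain ⟨δ, hδ⟩ : ∃ δ, δ = √(126 * (1 - p)) := ⟨_, rfl⟩
  have hδ0 : 0 ≤ δ := hδ ▸ Real.sqrt_nonneg _
  have hδ2 : δ ^ 2 = 126 * (1 - p) := by rw [hδ, Real.sq_sqrt (by positivity)]
  have hS : ∀ X, X.trace = 0 → ‖twirl M H X‖ ≤ δ * ‖X‖ := by
    intro X hX
    have h := sq_norm_twirl_sub_le hM hH X
    rw [hX, zero_div, zero_smul, sub_zero] at h
    apply le_of_sq_le_sq _ (by positivity)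
    rw [mul_pow, hδ2]
    refine h.trans ?_
    gcongr
    linarith
  have key := abs_trace_pow_sub_le hS hδ0 (by nlinarith) hA2 hAtr hA (by linarith) hp1 m
  -- the infidelity `1 - 𝔼 [Hᵢᵀ Mᵢ]` has a positive symmetric part with trace `O(1 - p)`
  obtain ⟨N, hN⟩ : ∃ N : Mat3, N = (Fintype.card ι : ℝ)⁻¹ • ∑ i, (H i)ᵀ * M i := ⟨_, rfl⟩
  have hNtr : ∀ X, (twirl M H X).trace = (N * X).trace := by
    intro X
    rw [twirl_apply, hN, Matrix.smul_mul, Matrix.trace_smul, Matrix.trace_smul, Finset.sum_mul,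
      Matrix.trace_sum, Matrix.trace_sum]
    congr 1
    refine Finset.sum_congr rfl fun i _ => ?_
    rw [Matrix.trace_mul_comm, mul_assoc]
  have hNpos : ∀ v, v ⬝ᵥ (N *ᵥ v) ≤ v ⬝ᵥ v := by
    intro v
    rw [hN, Matrix.smul_mulVec, dotProduct_smul, Matrix.sum_mulVec, dotProduct_sum, smul_eq_mul]
    apply inv_card_mul_sum_le
    intro i
    have h1 := hM i v
    have h2 : (H i *ᵥ v) ⬝ᵥ (H i *ᵥ v) = v ⬝ᵥ v := by
      rw [mulVec_dotProduct_mulVec, hH.orthogonal, Matrix.one_mulVec]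
    have h3 : v ⬝ᵥ (((H i)ᵀ * M i) *ᵥ v) = (H i *ᵥ v) ⬝ᵥ (M i *ᵥ v) := by
      rw [← Matrix.mulVec_mulVec, Matrix.dotProduct_mulVec v, Matrix.vecMul_transpose]
    have h4 : 0 ≤ (H i *ᵥ v - M i *ᵥ v) ⬝ᵥ (H i *ᵥ v - M i *ᵥ v) := by
      simp only [dotProduct]
      exact Finset.sum_nonneg fun j _ => mul_self_nonneg _
    rw [sub_dotProduct, dotProduct_sub, dotProduct_sub, h2,
      dotProduct_comm (M i *ᵥ v) (H i *ᵥ v)] at h4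
    rw [h3]
    linarith
  obtain ⟨Q, hQ⟩ : ∃ Q : Mat3, Q = 1 - (1 / 2 : ℝ) • (N + Nᵀ) := ⟨_, rfl⟩
  have hQs : Qᵀ = Q := by rw [hQ]; simp [add_comm]
  have hQpos : ∀ v, 0 ≤ v ⬝ᵥ (Q *ᵥ v) := by
    intro v
    rw [hQ, Matrix.sub_mulVec, dotProduct_sub, Matrix.smul_mulVec, dotProduct_smul,
      Matrix.add_mulVec, dotProduct_add, dotProduct_transpose_mulVec_self, Matrix.one_mulVec,
      smul_eq_mul]
    linarith [hNpos v]
  have hQtr : Q.trace = 3 - (twirl M H 1).trace := by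
    rw [hNtr, mul_one, hQ]
    simp [Matrix.trace_sub, Matrix.trace_add]
    ring
  have hQn := norm_le_of_posSemidef hQs hQpos
  -- A symmetric `A - 1` pairs to zero with the antisymmetric part of `N`. Without the gauge choice
  -- that part would contribute to the trace.
  have hQa : (twirl M H (A - 1)).trace = -(Qᵀ * (A - 1)).trace := by
    have h : (Nᵀ * (A - 1)).trace = (N * (A - 1)).trace := by
      rw [← Matrix.trace_transpose, Matrix.transpose_mul, Matrix.transpose_transpose, has,
        Matrix.trace_mul_comm]
    rw [hNtr, hQs, hQ, sub_mul, one_mul, Matrix.trace_sub, hatr, Matrix.smul_mul,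
      Matrix.trace_smul, add_mul, Matrix.trace_add, h, smul_eq_mul]
    ring
  have hSa : |(twirl M H (A - 1)).trace / 3| ≤ 1890 * (1 - p) ^ 2 := by
    rw [hQa, abs_div, abs_neg, abs_of_pos (by norm_num : (0 : ℝ) < 3)]
    calc _ ≤ ‖Q‖ * ‖A - 1‖ / 3 := by gcongr; exact abs_trace_transpose_mul_le _ _
      _ ≤ (189 * (1 - p)) * (30 * (1 - p)) / 3 := by gcongr; linarith
      _ = _ := by ring
  refine key.trans ?_
  calc _ ≤ 1890 * (1 - p) ^ 2 + (3 * δ) ^ 2 * (30 * (1 - p)) := by gcongr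
    _ = 1890 * (1 - p) ^ 2 + 34020 * (1 - p) ^ 2 := by rw [mul_pow, hδ2]; ring
    _ ≤ _ := by nlinarith

end Gauge

/-! ### Channels and designs in the Bloch picture -/

section Bloch

theorem pauli_conjTranspose (j : Fin 4) : (pauli j)ᴴ = pauli j := by
  ext a b
  fin_cases j <;> fin_cases a <;> fin_cases b <;> simp [pauli]

theorem trace_pauli_succ (j : Fin 3) : (pauli j.succ).trace = 0 := by
  fin_cases j <;> simp [pauli, Matrix.trace_fin_two]

theorem pauli_zero : pauli 0 = 1 := rfl

theorem hsInner_add_right (X Y Z : Op) : hsInner X (Y + Z) = hsInner X Y + hsInner X Z := by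
  simp [hsInner, mul_add]

theorem hsInner_add_left (X Y Z : Op) : hsInner (X + Y) Z = hsInner X Z + hsInner Y Z := by
  simp [hsInner, add_mul]

theorem hsInner_smul_right (c : ℂ) (X Y : Op) : hsInner X (c • Y) = c * hsInner X Y := by
  simp [hsInner]

theorem hsInner_im_of_hermitian {X Y : Op} (hX : Xᴴ = X) (hY : Yᴴ = Y) :
    (hsInner X Y).im = 0 := by
  rw [← Complex.conj_eq_iff_im, hsInner, ← Complex.star_def, ← Matrix.trace_conjTranspose,
    Matrix.conjTranspose_mul, hX, hY, hX, Matrix.trace_mul_comm]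

/-- The traceless Hermitian operator with Bloch vector `r`. -/
noncomputable def blochOp : (Fin 3 → ℝ) →ₗ[ℝ] Op where
  toFun r := ∑ j, (r j : ℂ) • pauli j.succ
  map_add' r s := by simp [add_smul, Finset.sum_add_distrib]
  map_smul' c r := by
    simp only [Pi.smul_apply, smul_eq_mul, Complex.ofReal_mul, mul_smul, RingHom.id_apply,
      ← Finset.smul_sum]
    rfl

theorem blochOp_apply (r : Fin 3 → ℝ) : blochOp r = ∑ j, (r j : ℂ) • pauli j.succ := rfl

theorem blochOp_eq (r : Fin 3 → ℝ) :
    blochOp r = !![(r 2 : ℂ), r 0 - r 1 * Complex.I; r 0 + r 1 * Complex.I, -r 2] := by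
  ext a b
  fin_cases a <;> fin_cases b <;>
    simp [blochOp_apply, Fin.sum_univ_three, pauli, sub_eq_add_neg]

theorem blochOp_single (k : Fin 3) : blochOp (Pi.single k 1) = pauli k.succ := by
  simp [blochOp_apply, Pi.single_apply]

theorem blochOp_conjTranspose (r : Fin 3 → ℝ) : (blochOp r)ᴴ = blochOp r := by
  simp [blochOp_apply, Matrix.conjTranspose_sum, Matrix.conjTranspose_smul, pauli_conjTranspose]

theorem trace_blochOp (r : Fin 3 → ℝ) : (blochOp r).trace = 0 := by
  simp [blochOp_eq, Matrix.trace_fin_two]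

theorem blochOp_mul_self (r : Fin 3 → ℝ) : blochOp r * blochOp r = ((r ⬝ᵥ r : ℝ) : ℂ) • 1 := by
  have hI := Complex.I_sq
  rw [blochOp_eq]
  ext a b
  fin_cases a <;> fin_cases b <;>
    simp [Matrix.mul_apply, Fin.sum_univ_two, dotProduct, Fin.sum_univ_three] <;>
    first | ring1 | linear_combination (-(r 1 : ℂ) ^ 2) * hI

theorem det_one_add_blochOp (r : Fin 3 → ℝ) :
    (1 + blochOp r).det = ((1 - r ⬝ᵥ r : ℝ) : ℂ) := by
  have hI := Complex.I_sq
  rw [blochOp_eq, Matrix.det_fin_two]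
  simp [dotProduct, Fin.sum_univ_three]
  linear_combination ((r 1 : ℂ) ^ 2) * hI

theorem hsInner_blochOp (r s : Fin 3 → ℝ) :
    hsInner (blochOp r) (blochOp s) = ((2 * (r ⬝ᵥ s) : ℝ) : ℂ) := by
  have hI := Complex.I_sq
  rw [hsInner, blochOp_conjTranspose, blochOp_eq, blochOp_eq]
  simp [Matrix.trace_fin_two, dotProduct, Fin.sum_univ_three]
  linear_combination (-2 * (r 1 : ℂ) * s 1) * hI

theorem hsInner_blochOp_one (r : Fin 3 → ℝ) : hsInner (blochOp r) 1 = 0 := by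
  simp [hsInner, blochOp_conjTranspose, trace_blochOp]

/-- The Bloch vector of an operator. -/
noncomputable def blochVec (X : Op) : Fin 3 → ℝ := fun j => (hsInner (pauli j.succ) X).re / 2

theorem blochVec_blochOp (r : Fin 3 → ℝ) : blochVec (blochOp r) = r := by
  ext j
  rw [blochVec, ← blochOp_single, hsInner_blochOp]
  simp

theorem hermitian_eq {X : Op} (hX : Xᴴ = X) :
    X = (X.trace / 2) • (1 : Op) + blochOp (blochVec X) := by
  have h : ∀ a b, star (X b a) = X a b := fun a b => congrFun (congrFun hX a) b
  have h00 : (X 0 0).im = 0 := Complex.conj_eq_iff_im.1 (h 0 0)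
  have h11 : (X 1 1).im = 0 := Complex.conj_eq_iff_im.1 (h 1 1)
  have h01 := h 0 1
  have hre : (X 1 0).re = (X 0 1).re := by rw [← h01]; simp
  have him : (X 1 0).im = -(X 0 1).im := by rw [← h01]; simp
  rw [blochOp_eq]
  ext a b
  fin_cases a <;> fin_cases b <;> apply Complex.ext <;>
    simp [blochVec, hsInner, pauli, Matrix.trace_fin_two, Matrix.mul_apply, Fin.sum_univ_two,
      h00, h11, hre, him] <;> ring

/-- Maps that preserve Hermiticity and the trace. -/
structure IsHermitianTP (Φ : SuperOp) : Prop where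
  hermitian : ∀ X : Op, Xᴴ = X → (Φ X)ᴴ = Φ X
  trace : ∀ X : Op, (Φ X).trace = X.trace

theorem IsHermitianTP.one : IsHermitianTP 1 := ⟨fun _ h => h, fun _ => rfl⟩

theorem IsHermitianTP.mul {Φ Ψ : SuperOp} (hΦ : IsHermitianTP Φ) (hΨ : IsHermitianTP Ψ) :
    IsHermitianTP (Φ * Ψ) :=
  ⟨fun X h => hΦ.hermitian _ (hΨ.hermitian X h), fun X => (hΦ.trace _).trans (hΨ.trace X)⟩

/-- The action on Bloch vectors of the unital part of a linear map. -/
noncomputable def bloch (Φ : SuperOp) : Mat3 :=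
  Matrix.of fun j k => blochVec (Φ (pauli k.succ)) j

theorem IsHermitianTP.map_blochOp {Φ : SuperOp} (hΦ : IsHermitianTP Φ) (v : Fin 3 → ℝ) :
    Φ (blochOp v) = blochOp (bloch Φ *ᵥ v) := by
  have h : ∀ k : Fin 3, Φ (pauli k.succ) = blochOp (fun j => bloch Φ j k) := by
    intro k
    have := hermitian_eq (hΦ.hermitian _ (pauli_conjTranspose k.succ))
    rw [hΦ.trace, trace_pauli_succ, zero_div, zero_smul, zero_add] at this
    exact this
  rw [blochOp_apply, map_sum]
  have h2 : bloch Φ *ᵥ v = ∑ k, v k • (fun j => bloch Φ j k) := by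
    ext j
    simp [Matrix.mulVec, dotProduct, mul_comm]
  rw [h2, map_sum]
  refine Finset.sum_congr rfl fun k _ => ?_
  rw [map_smul, h, map_smul]
  rfl

theorem IsHermitianTP.map_one {Φ : SuperOp} (hΦ : IsHermitianTP Φ) :
    Φ 1 = 1 + blochOp (blochVec (Φ 1)) := by
  have h := hermitian_eq (hΦ.hermitian 1 (by simp))
  rw [hΦ.trace] at h
  simpa using h

theorem bloch_eq_of_map_blochOp {Φ : SuperOp} {M : Mat3}
    (h : ∀ v, Φ (blochOp v) = blochOp (M *ᵥ v)) : bloch Φ = M := by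
  ext j k
  rw [bloch, Matrix.of_apply, ← blochOp_single, h, blochVec_blochOp]
  simp

theorem IsHermitianTP.bloch_mul {Φ Ψ : SuperOp} (hΦ : IsHermitianTP Φ) (hΨ : IsHermitianTP Ψ) :
    bloch (Φ * Ψ) = bloch Φ * bloch Ψ := by
  apply bloch_eq_of_map_blochOp
  intro v
  rw [Module.End.mul_apply, hΨ.map_blochOp, hΦ.map_blochOp, Matrix.mulVec_mulVec]

theorem bloch_one : bloch 1 = 1 := by
  apply bloch_eq_of_map_blochOp
  intro v
  simp

theorem IsChannel.posSemidef {Φ : SuperOp} (hΦ : IsChannel Φ) {X : Op} (hX : X.PosSemidef) :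
    (Φ X).PosSemidef := by
  have h := hΦ.completelyPositive 1 (X.submatrix Prod.fst Prod.fst) (hX.submatrix _)
  exact h.submatrix (fun i : Fin 2 => (i, (0 : Fin 1)))

/-- A Hermitian `X` is a difference of positive operators, `((X + 1)² - (X - 1)²)/4`, and positivity
of the images includes Hermiticity. -/
theorem IsChannel.isHermitianTP {Φ : SuperOp} (hΦ : IsChannel Φ) : IsHermitianTP Φ := by
  refine ⟨fun X hX => ?_, hΦ.tracePreserving⟩
  have h : X = (1 / 4 : ℝ) • ((X + 1)ᴴ * (X + 1) - (X - 1)ᴴ * (X - 1)) := by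
    rw [Matrix.conjTranspose_add, Matrix.conjTranspose_sub, hX, Matrix.conjTranspose_one]
    have : (X + 1) * (X + 1) - (X - 1) * (X - 1) = (4 : ℝ) • X := by
      simp only [add_mul, mul_add, sub_mul, mul_sub, one_mul, mul_one]
      module
    rw [this, smul_smul]
    norm_num
  have h1 := (hΦ.posSemidef (Matrix.posSemidef_conjTranspose_mul_self (X + 1))).1
  have h2 := (hΦ.posSemidef (Matrix.posSemidef_conjTranspose_mul_self (X - 1))).1
  rw [h]
  have hr : Φ ((1 / 4 : ℝ) • ((X + 1)ᴴ * (X + 1) - (X - 1)ᴴ * (X - 1)))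
      = (1 / 4 : ℝ) • (Φ ((X + 1)ᴴ * (X + 1)) - Φ ((X - 1)ᴴ * (X - 1))) := by
    rw [← map_sub]
    exact map_smul Φ ((1 / 4 : ℝ) : ℂ) _
  rw [hr, Matrix.conjTranspose_smul, Matrix.conjTranspose_sub, h1, h2]
  simp

/-- For a unit vector `v` the operator `1 + v·σ` is half its own square, hence positive. Its image
is then positive, and the determinant of the image is 1 minus the squared length of the new Bloch
vector. -/
theorem IsChannel.sq_le_one {Φ : SuperOp} (hΦ : IsChannel Φ) {v : Fin 3 → ℝ} (hv : v ⬝ᵥ v = 1) :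
    (blochVec (Φ 1) + bloch Φ *ᵥ v) ⬝ᵥ (blochVec (Φ 1) + bloch Φ *ᵥ v) ≤ 1 := by
  have hpos : (1 + blochOp v).PosSemidef := by
    have h : 1 + blochOp v = (1 / 2 : ℝ) • ((1 + blochOp v)ᴴ * (1 + blochOp v)) := by
      rw [Matrix.conjTranspose_add, blochOp_conjTranspose, Matrix.conjTranspose_one, add_mul,
        mul_add, mul_add, blochOp_mul_self, hv]
      simp only [Complex.ofReal_one, one_smul, one_mul, mul_one]
      module
    rw [h]
    exact (Matrix.posSemidef_conjTranspose_mul_self _).smul (by norm_num)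
  have h1 := (hΦ.posSemidef hpos).det_nonneg
  have hΦ' := hΦ.isHermitianTP
  rw [map_add, hΦ'.map_one, hΦ'.map_blochOp, add_assoc, ← map_add, det_one_add_blochOp] at h1
  have h2 : 0 ≤ 1 - (blochVec (Φ 1) + bloch Φ *ᵥ v) ⬝ᵥ (blochVec (Φ 1) + bloch Φ *ᵥ v) := by
    exact_mod_cast h1
  linarith

/-- Adding the bounds for `v` and `-v` cancels the cross terms with the translation, so the linear
part alone maps unit vectors into the unit ball. -/
theorem IsChannel.isContraction {Φ : SuperOp} (hΦ : IsChannel Φ) : IsContraction (bloch Φ) := by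
  have hunit : ∀ v : Fin 3 → ℝ, v ⬝ᵥ v = 1 → (bloch Φ *ᵥ v) ⬝ᵥ (bloch Φ *ᵥ v) ≤ 1 := by
    intro v hv
    have h1 := hΦ.sq_le_one hv
    have h2 := hΦ.sq_le_one (v := -v) (by simpa using hv)
    rw [Matrix.mulVec_neg] at h2
    have h3 : 0 ≤ blochVec (Φ 1) ⬝ᵥ blochVec (Φ 1) := by
      simp only [dotProduct]
      exact Finset.sum_nonneg fun j _ => mul_self_nonneg _
    simp only [add_dotProduct, dotProduct_add, neg_dotProduct, dotProduct_neg] at h1 h2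
    linarith
  intro v
  have h0 : 0 ≤ v ⬝ᵥ v := by
    simp only [dotProduct]
    exact Finset.sum_nonneg fun j _ => mul_self_nonneg _
  rcases h0.eq_or_lt with h | h
  · rw [dotProduct_self_eq_zero.1 h.symm]; simp
  · have hs : 0 < √(v ⬝ᵥ v) := Real.sqrt_pos.2 h
    have hss : √(v ⬝ᵥ v) * √(v ⬝ᵥ v) = v ⬝ᵥ v := Real.mul_self_sqrt h0
    have h1 := hunit ((√(v ⬝ᵥ v))⁻¹ • v) (by
      rw [smul_dotProduct, dotProduct_smul, smul_eq_mul, smul_eq_mul]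
      field_simp
      rw [sq, hss])
    rw [Matrix.mulVec_smul, smul_dotProduct, dotProduct_smul, smul_eq_mul, smul_eq_mul,
      ← mul_assoc, ← mul_inv, hss, inv_mul_le_iff₀ h, mul_one] at h1
    exact h1

abbrev U2 : Type := Matrix.unitaryGroup (Fin 2) ℂ

theorem coe_conjTranspose_mul_self (u : U2) : (u : Op)ᴴ * (u : Op) = 1 :=
  Matrix.mem_unitaryGroup_iff'.1 u.2

theorem unitaryChannel_apply (u : U2) (X : Op) :
    unitaryChannel u X = (u : Op) * X * (u : Op)ᴴ := rfl

theorem unitaryChannel_mul (u w : U2) :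
    unitaryChannel (u * w) = unitaryChannel u * unitaryChannel w := by
  refine LinearMap.ext fun X => ?_
  simp [unitaryChannel_apply, mul_assoc]

theorem unitaryChannel_one : unitaryChannel 1 = 1 := by
  refine LinearMap.ext fun X => ?_
  simp [unitaryChannel_apply]

theorem isHermitianTP_unitaryChannel (u : U2) : IsHermitianTP (unitaryChannel u) := by
  refine ⟨fun X hX => ?_, fun X => ?_⟩
  · simp [unitaryChannel_apply, hX, mul_assoc]
  · rw [unitaryChannel_apply, Matrix.trace_mul_comm, ← mul_assoc, coe_conjTranspose_mul_self,
      one_mul]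

/-- The rotation of the Bloch sphere given by a unitary. -/
noncomputable def rotation (u : U2) : Mat3 := bloch (unitaryChannel u)

theorem rotation_mul (u w : U2) : rotation (u * w) = rotation u * rotation w := by
  rw [rotation, unitaryChannel_mul,
    (isHermitianTP_unitaryChannel u).bloch_mul (isHermitianTP_unitaryChannel w)]
  rfl

theorem rotation_one : rotation 1 = 1 := by rw [rotation, unitaryChannel_one, bloch_one]

theorem unitaryChannel_blochOp (u : U2) (v : Fin 3 → ℝ) :
    unitaryChannel u (blochOp v) = blochOp (rotation u *ᵥ v) :=
  (isHermitianTP_unitaryChannel u).map_blochOp v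

theorem rotation_transpose_mul_self (u : U2) : (rotation u)ᵀ * rotation u = 1 := by
  have h : ∀ v w : Fin 3 → ℝ, (rotation u *ᵥ v) ⬝ᵥ (rotation u *ᵥ w) = v ⬝ᵥ w := by
    intro v w
    have h1 := hsInner_blochOp (rotation u *ᵥ v) (rotation u *ᵥ w)
    have h2 := hsInner_blochOp v w
    rw [← unitaryChannel_blochOp, ← unitaryChannel_blochOp, hsInner, unitaryChannel_apply,
      unitaryChannel_apply, Matrix.conjTranspose_mul, Matrix.conjTranspose_mul,
      Matrix.conjTranspose_conjTranspose] at h1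
    have h3 : (u : Op) * ((blochOp v)ᴴ * (u : Op)ᴴ) * ((u : Op) * blochOp w * (u : Op)ᴴ)
        = (u : Op) * ((blochOp v)ᴴ * blochOp w) * (u : Op)ᴴ := by
      calc _ = (u : Op) * ((blochOp v)ᴴ * ((u : Op)ᴴ * (u : Op)) * blochOp w) * (u : Op)ᴴ := by
            simp only [mul_assoc]
        _ = _ := by rw [coe_conjTranspose_mul_self, mul_one]
    rw [h3, Matrix.trace_mul_comm, ← mul_assoc, coe_conjTranspose_mul_self, one_mul] at h1
    rw [hsInner, h1] at h2
    have h4 := Complex.ofReal_injective h2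
    linarith
  ext j k
  have := h (Pi.single j 1) (Pi.single k 1)
  simp at this
  rw [Matrix.mul_apply, Matrix.one_apply]
  simpa [dotProduct, Pi.single_apply, eq_comm] using this

theorem rotation_mul_transpose_self (u : U2) : rotation u * (rotation u)ᵀ = 1 :=
  mul_eq_one_comm.1 (rotation_transpose_mul_self u)

theorem rotation_inv (u : U2) : rotation u⁻¹ = (rotation u)ᵀ := by
  have h : rotation u⁻¹ * rotation u = 1 := by rw [← rotation_mul, inv_mul_cancel, rotation_one]
  calc rotation u⁻¹ = rotation u⁻¹ * (rotation u * (rotation u)ᵀ) := by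
        rw [rotation_mul_transpose_self, mul_one]
    _ = _ := by rw [← mul_assoc, h, one_mul]

variable {ι : Type*} [Fintype ι]

theorem inv_card_smul_ofReal (X : Op) :
    (Fintype.card ι : ℂ)⁻¹ • X = (Fintype.card ι : ℝ)⁻¹ • X := by
  have : ((Fintype.card ι : ℂ)⁻¹) = (((Fintype.card ι : ℝ)⁻¹ : ℝ) : ℂ) := by simp
  rw [this]
  rfl

/-- The design property is applied to a superoperator with Bloch matrix `X`: its twirl is scalar on
traceless operators, and conjugation by rotations preserves the trace, which fixes the scalar. -/
theorem IsTwoDesign.isOrthogonalTwirl {u : ι → U2} (hu : IsTwoDesign u) [Nonempty ι] :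
    IsOrthogonalTwirl fun i => rotation (u i) := by
  refine ⟨fun i => rotation_transpose_mul_self _, fun X => ?_⟩
  -- The factor `1/2` compensates `tr(σ²) = 2` for a Pauli matrix `σ`.
  let Λ : SuperOp := ∑ j, ∑ k, ((X j k : ℂ) / 2) •
    ((Matrix.traceLinearMap (Fin 2) ℂ ℂ).comp
      (LinearMap.mulLeft ℂ (pauli k.succ)ᴴ)).smulRight (pauli j.succ)
  have hΛ : ∀ v, Λ (blochOp v) = blochOp (X *ᵥ v) := by
    intro v
    rw [blochOp_apply (X *ᵥ v)]
    simp only [Λ, LinearMap.sum_apply, LinearMap.smul_apply, LinearMap.smulRight_apply,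
      LinearMap.comp_apply, LinearMap.mulLeft_apply, Matrix.traceLinearMap_apply]
    refine Finset.sum_congr rfl fun j _ => ?_
    simp only [smul_smul, ← Finset.sum_smul]
    congr 1
    simp only [Matrix.mulVec, dotProduct, Complex.ofReal_sum]
    refine Finset.sum_congr rfl fun k _ => ?_
    have h := hsInner_blochOp (Pi.single k 1) v
    rw [blochOp_single, hsInner] at h
    rw [h]
    simp
    ring
  obtain ⟨a, b, hab⟩ := hu Λ
  have key : ∀ v, twirl (fun i => rotation (u i)) (fun i => rotation (u i)) X *ᵥ v
      = a.re • v := by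
    intro v
    have h := hab (blochOp v)
    rw [trace_blochOp, mul_zero, zero_smul, add_zero, inv_card_smul_ofReal] at h
    have h1 : ∀ i, (unitaryChannel (u i) * Λ * unitaryChannel (u i)⁻¹) (blochOp v)
        = blochOp ((rotation (u i) * X * (rotation (u i))ᵀ) *ᵥ v) := by
      intro i
      rw [Module.End.mul_apply, Module.End.mul_apply, unitaryChannel_blochOp, hΛ,
        unitaryChannel_blochOp, rotation_inv, Matrix.mulVec_mulVec, Matrix.mulVec_mulVec,
        mul_assoc]
    simp only [h1] at h
    rw [← map_sum, ← map_smul, ← Matrix.sum_mulVec, ← Matrix.smul_mulVec] at h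
    have h2 := congrArg blochVec h
    rw [blochVec_blochOp] at h2
    rw [twirl_apply, h2]
    ext j
    rw [blochVec, hsInner_smul_right, ← blochOp_single, hsInner_blochOp]
    simp
    ring
  have h3 : twirl (fun i => rotation (u i)) (fun i => rotation (u i)) X = a.re • (1 : Mat3) := by
    apply Matrix.ext_of_mulVec_single
    intro k
    rw [key, Matrix.smul_mulVec, Matrix.one_mulVec]
  have h4 : (twirl (fun i => rotation (u i)) (fun i => rotation (u i)) X).trace = X.trace := by
    rw [twirl_apply, Matrix.trace_smul, Matrix.trace_sum]
    have : ∀ i, (rotation (u i) * X * (rotation (u i))ᵀ).trace = X.trace := fun i => by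
      rw [Matrix.trace_mul_comm, ← mul_assoc, rotation_transpose_mul_self, one_mul]
    simp [this]
  rw [h3] at h4 ⊢
  rw [← h4]
  simp

/-- Twirling `Y ↦ tr(Y) σₖ` and evaluating at `1` gives twice the mean rotation of `σₖ`. The design
property makes the result scalar, so its Bloch vector vanishes. -/
theorem IsTwoDesign.sum_rotation {u : ι → U2} (hu : IsTwoDesign u) [Nonempty ι] :
    ∑ i, rotation (u i) = 0 := by
  apply Matrix.ext_of_mulVec_single
  intro k
  let Λ : SuperOp := (Matrix.traceLinearMap (Fin 2) ℂ ℂ).smulRight (blochOp (Pi.single k 1))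
  obtain ⟨a, b, hab⟩ := hu Λ
  have h := hab 1
  have h1 : ∀ i, (unitaryChannel (u i) * Λ * unitaryChannel (u i)⁻¹) 1
      = blochOp ((2 : ℝ) • (rotation (u i) *ᵥ Pi.single k 1)) := by
    intro i
    have h2 : Λ (unitaryChannel (u i)⁻¹ 1) = (2 : ℂ) • blochOp (Pi.single k 1) := by
      simp only [Λ, LinearMap.smulRight_apply, Matrix.traceLinearMap_apply]
      rw [(isHermitianTP_unitaryChannel _).trace]
      simp
    rw [Module.End.mul_apply, Module.End.mul_apply, h2, map_smul, unitaryChannel_blochOp,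
      map_smul]
    exact (Complex.coe_smul (2 : ℝ) _)
  simp only [h1] at h
  rw [inv_card_smul_ofReal, ← map_sum, ← map_smul] at h
  have h3 := congrArg blochVec h
  rw [blochVec_blochOp, ← Finset.smul_sum, ← Matrix.sum_mulVec] at h3
  have h4 : blochVec (a • (1 : Op) + (b * (1 : Op).trace) • (1 : Op)) = 0 := by
    ext j
    rw [blochVec, ← add_smul, hsInner_smul_right, ← blochOp_single, hsInner_blochOp_one]
    simp
  rw [h4, smul_smul] at h3
  have hc : (Fintype.card ι : ℝ)⁻¹ * 2 ≠ 0 := by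
    have := cast_card_pos (ι := ι)
    positivity
  rw [(smul_eq_zero.1 h3).resolve_left hc, Matrix.zero_mulVec]

end Bloch

/-! ### Rotations about the coordinate axes -/

section AxisRotations

/-- The unitary `exp (-i θ Z)` with `α = cos θ`, `β = sin θ`. -/
noncomputable def unitaryZ (α β : ℝ) (h : α ^ 2 + β ^ 2 = 1) : U2 :=
  ⟨!![(α : ℂ) - β * Complex.I, 0; 0, α + β * Complex.I], by
    have h' : (α : ℂ) ^ 2 + (β : ℂ) ^ 2 = 1 := by exact_mod_cast h
    have hI := Complex.I_sq
    rw [Matrix.mem_unitaryGroup_iff, Matrix.star_eq_conjTranspose]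
    ext a b
    fin_cases a <;> fin_cases b <;>
      simp [Matrix.mul_apply, Fin.sum_univ_two, Matrix.conjTranspose_apply] <;>
      linear_combination h' - (β : ℂ) ^ 2 * hI⟩

/-- The unitary `exp (-i θ X)` with `α = cos θ`, `β = sin θ`. -/
noncomputable def unitaryX (α β : ℝ) (h : α ^ 2 + β ^ 2 = 1) : U2 :=
  ⟨!![(α : ℂ), -(β * Complex.I); -(β * Complex.I), α], by
    have h' : (α : ℂ) ^ 2 + (β : ℂ) ^ 2 = 1 := by exact_mod_cast h
    have hI := Complex.I_sq
    rw [Matrix.mem_unitaryGroup_iff, Matrix.star_eq_conjTranspose]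
    ext a b
    fin_cases a <;> fin_cases b <;>
      simp [Matrix.mul_apply, Fin.sum_univ_two, Matrix.conjTranspose_apply] <;>
      first | ring1 | linear_combination h' - (β : ℂ) ^ 2 * hI⟩

/-- The unitary `exp (-i θ Y)` with `α = cos θ`, `β = sin θ`. -/
noncomputable def unitaryY (α β : ℝ) (h : α ^ 2 + β ^ 2 = 1) : U2 :=
  ⟨!![(α : ℂ), -β; β, α], by
    have h' : (α : ℂ) ^ 2 + (β : ℂ) ^ 2 = 1 := by exact_mod_cast h
    rw [Matrix.mem_unitaryGroup_iff, Matrix.star_eq_conjTranspose]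
    ext a b
    fin_cases a <;> fin_cases b <;>
      simp [Matrix.mul_apply, Fin.sum_univ_two, Matrix.conjTranspose_apply] <;>
      first | ring1 | linear_combination h'⟩

variable (α β : ℝ) (h : α ^ 2 + β ^ 2 = 1)

theorem rotation_unitaryZ : rotation (unitaryZ α β h)
    = !![α ^ 2 - β ^ 2, -(2 * α * β), 0; 2 * α * β, α ^ 2 - β ^ 2, 0; 0, 0, 1] := by
  have h' : (α : ℂ) ^ 2 + (β : ℂ) ^ 2 = 1 := by exact_mod_cast h
  have hI := Complex.I_sq
  have hI4 : Complex.I ^ 3 = -Complex.I := by rw [pow_succ, hI]; ring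
  apply bloch_eq_of_map_blochOp
  intro v
  rw [unitaryChannel_apply, blochOp_eq, blochOp_eq]
  ext a b
  fin_cases a <;> fin_cases b <;>
    simp [unitaryZ, Matrix.mul_apply, Fin.sum_univ_two, Matrix.conjTranspose_apply,
      Matrix.mulVec, dotProduct, Fin.sum_univ_three] <;> ring_nf <;>
    simp only [hI, hI4] <;>
    first | ring1 | linear_combination (v 2 : ℂ) * h'

theorem rotation_unitaryX : rotation (unitaryX α β h)
    = !![1, 0, 0; 0, α ^ 2 - β ^ 2, -(2 * α * β); 0, 2 * α * β, α ^ 2 - β ^ 2] := by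
  have h' : (α : ℂ) ^ 2 + (β : ℂ) ^ 2 = 1 := by exact_mod_cast h
  have hI := Complex.I_sq
  have hI4 : Complex.I ^ 3 = -Complex.I := by rw [pow_succ, hI]; ring
  apply bloch_eq_of_map_blochOp
  intro v
  rw [unitaryChannel_apply, blochOp_eq, blochOp_eq]
  ext a b
  fin_cases a <;> fin_cases b <;>
    simp [unitaryX, Matrix.mul_apply, Fin.sum_univ_two, Matrix.conjTranspose_apply,
      Matrix.mulVec, dotProduct, Fin.sum_univ_three] <;> ring_nf <;>
    simp only [hI, hI4] <;>
    first | ring1 | linear_combination (v 0 : ℂ) * h'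

theorem rotation_unitaryY : rotation (unitaryY α β h)
    = !![α ^ 2 - β ^ 2, 0, 2 * α * β; 0, 1, 0; -(2 * α * β), 0, α ^ 2 - β ^ 2] := by
  have h' : (α : ℂ) ^ 2 + (β : ℂ) ^ 2 = 1 := by exact_mod_cast h
  apply bloch_eq_of_map_blochOp
  intro v
  rw [unitaryChannel_apply, blochOp_eq, blochOp_eq]
  ext a b
  fin_cases a <;> fin_cases b <;>
    simp [unitaryY, Matrix.mul_apply, Fin.sum_univ_two, Matrix.conjTranspose_apply,
      Matrix.mulVec, dotProduct, Fin.sum_univ_three] <;> ring_nf <;>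
    first
    | ring1
    | linear_combination (v 1 : ℂ) * Complex.I * h'
    | linear_combination -(v 1 : ℂ) * Complex.I * h'

end AxisRotations

/-! ### Moments of the uniform pure state and the average fidelity -/

section Sphere

open scoped Pointwise

/-- The spherical measure of a set is a multiple of the volume of the cone over it; a linear
isometry commutes with forming cones and preserves volume. -/
theorem measurePreserving_toSphere {E : Type*} [NormedAddCommGroup E] [InnerProductSpace ℝ E]
    [FiniteDimensional ℝ E] [MeasurableSpace E] [BorelSpace E] (f : E ≃ₗᵢ[ℝ] E)
    {F : Metric.sphere (0 : E) 1 → Metric.sphere (0 : E) 1} (hF : ∀ x, (F x : E) = f x) :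
    MeasurePreserving F (volume : Measure E).toSphere (volume : Measure E).toSphere := by
  have hFc : Continuous F := by
    rw [continuous_induced_rng]
    exact (f.continuous.comp continuous_subtype_val).congr fun x => (hF x).symm
  refine ⟨hFc.measurable, Measure.ext fun s hs => ?_⟩
  rw [Measure.map_apply hFc.measurable hs, Measure.toSphere_apply' _ (hFc.measurable hs),
    Measure.toSphere_apply' _ hs]
  congr 1
  rw [← f.measurePreserving.measure_preimage_emb f.toMeasurableEquiv.measurableEmbedding
    (Set.Ioo (0 : ℝ) 1 • Set.image Subtype.val s)]
  congr 1
  ext x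
  simp only [Set.mem_smul, Set.mem_image, Set.mem_preimage, Subtype.exists, exists_and_right,
    exists_eq_right]
  constructor
  · rintro ⟨r, hr, y, ⟨hy, hys⟩, rfl⟩
    refine ⟨r, hr, F ⟨y, hy⟩, ⟨(F ⟨y, hy⟩).2, hys⟩, ?_⟩
    rw [hF, map_smul]
  · rintro ⟨r, hr, z, ⟨hz, hzs⟩, hx⟩
    have hy : f.symm z ∈ Metric.sphere (0 : E) 1 := by simpa using hz
    refine ⟨r, hr, f.symm z, ⟨hy, ?_⟩, ?_⟩
    · have : F ⟨f.symm z, hy⟩ = ⟨z, hz⟩ := Subtype.ext (by rw [hF]; simp)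
      rwa [this]
    · apply f.injective
      rw [← hx, map_smul, f.apply_symm_apply]

abbrev Ket : Type := EuclideanSpace ℂ (Fin 2)

theorem trace_pureState (ψ : Ket) : (pureState ψ).trace = ((‖ψ‖ ^ 2 : ℝ) : ℂ) := by
  rw [EuclideanSpace.norm_sq_eq]
  simp [pureState, Matrix.trace_fin_two, Fin.sum_univ_two, Complex.mul_conj,
    Complex.normSq_eq_norm_sq]

theorem pureState_conjTranspose (ψ : Ket) : (pureState ψ)ᴴ = pureState ψ := by
  ext a b
  simp [pureState, Matrix.conjTranspose_apply, mul_comm]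

theorem det_pureState (ψ : Ket) : (pureState ψ).det = 0 := by
  simp [pureState, Matrix.det_fin_two]
  ring

theorem pureState_toEuclideanLin (u : U2) (ψ : Ket) :
    pureState (Matrix.toEuclideanLin (u : Op) ψ) = unitaryChannel u (pureState ψ) := by
  ext a b
  simp [pureState, unitaryChannel_apply, Matrix.mul_apply, Fin.sum_univ_two,
    Matrix.conjTranspose_apply, Matrix.toLpLin_apply]
  fin_cases a <;> fin_cases b <;> simp <;> ring

/-- The isometry of `ℂ²` given by a unitary. -/
noncomputable def ketIsometry (u : U2) : Ket ≃ₗᵢ[ℝ] Ket :=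
  LinearIsometry.toLinearIsometryEquiv
    { toLinearMap := (Matrix.toEuclideanLin (u : Op)).restrictScalars ℝ
      norm_map' := fun ψ => by
        have h := trace_pureState (Matrix.toEuclideanLin (u : Op) ψ)
        rw [pureState_toEuclideanLin, (isHermitianTP_unitaryChannel u).trace,
          trace_pureState] at h
        have h1 : ‖ψ‖ ^ 2 = ‖Matrix.toEuclideanLin (u : Op) ψ‖ ^ 2 := by exact_mod_cast h
        exact ((pow_left_inj₀ (norm_nonneg _) (norm_nonneg _) two_ne_zero).1 h1).symm } rfl

theorem pureState_ketIsometry (u : U2) (ψ : Ket) :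
    pureState (ketIsometry u ψ) = unitaryChannel u (pureState ψ) :=
  pureState_toEuclideanLin u ψ

/-- The uniform measure on the unit sphere of `ℂ²` (not normalized). -/
noncomputable abbrev sphereMeasure : Measure (Metric.sphere (0 : Ket) 1) :=
  (volume : Measure Ket).toSphere

/-- The Bloch vector of the pure state of a unit vector. -/
noncomputable def stateVec (ψ : Metric.sphere (0 : Ket) 1) : Fin 3 → ℝ := blochVec (pureState ψ)

theorem pureState_eq (ψ : Metric.sphere (0 : Ket) 1) :
    pureState ψ = (1 / 2 : ℂ) • (1 : Op) + blochOp (stateVec ψ) := by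
  have h := hermitian_eq (pureState_conjTranspose ψ)
  rw [trace_pureState] at h
  simpa [stateVec] using h

theorem stateVec_dotProduct_self (ψ : Metric.sphere (0 : Ket) 1) :
    stateVec ψ ⬝ᵥ stateVec ψ = 1 / 4 := by
  have h1 : pureState ψ = (1 / 2 : ℂ) • (1 + blochOp ((2 : ℝ) • stateVec ψ)) := by
    rw [pureState_eq, smul_add, map_smul, ← Complex.coe_smul, smul_smul]
    norm_num
  have h := det_pureState ψ
  rw [h1, Matrix.det_smul, det_one_add_blochOp] at h
  have h2 : (1 : ℝ) - ((2 : ℝ) • stateVec ψ) ⬝ᵥ ((2 : ℝ) • stateVec ψ) = 0 := by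
    have := (mul_eq_zero.1 h).resolve_left (by norm_num)
    exact_mod_cast this
  rw [smul_dotProduct, dotProduct_smul, smul_eq_mul, smul_eq_mul] at h2
  linarith

theorem continuous_stateVec (j : Fin 3) : Continuous fun ψ => stateVec ψ j := by
  have h : Continuous fun ψ : Metric.sphere (0 : Ket) 1 => pureState ψ := by
    unfold pureState
    fun_prop
  unfold stateVec blochVec hsInner
  fun_prop

/-- Unitaries act on states by rotating Bloch vectors, and preserve the uniform measure. -/
theorem integral_stateVec_rotation (u : U2) {g : (Fin 3 → ℝ) → ℝ} (hg : Continuous g) :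
    ∫ ψ, g (rotation u *ᵥ stateVec ψ) ∂sphereMeasure = ∫ ψ, g (stateVec ψ) ∂sphereMeasure := by
  let F : Metric.sphere (0 : Ket) 1 → Metric.sphere (0 : Ket) 1 :=
    fun ψ => ⟨ketIsometry u ψ, by simp⟩
  have hF := measurePreserving_toSphere (ketIsometry u) (F := F) fun _ => rfl
  have hstate : ∀ ψ, stateVec (F ψ) = rotation u *ᵥ stateVec ψ := by
    intro ψ
    have h := pureState_ketIsometry u ψ
    rw [pureState_eq ψ, map_add, map_smul, unitaryChannel_blochOp] at h
    have h1 : unitaryChannel u 1 = 1 := by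
      rw [unitaryChannel_apply, mul_one]
      exact Matrix.mem_unitaryGroup_iff.1 u.2
    have h2 : pureState (ketIsometry u ψ) = _ := pureState_eq (F ψ)
    rw [h1, h2] at h
    have h3 := congrArg blochVec (add_left_cancel h)
    rwa [blochVec_blochOp, blochVec_blochOp] at h3
  have hc : Continuous stateVec := continuous_pi continuous_stateVec
  have h := integral_map (μ := sphereMeasure) hF.measurable.aemeasurable
    (f := fun ψ => g (stateVec ψ)) (hg.comp hc).aestronglyMeasurable
  rw [hF.map_eq] at h
  rw [h]
  simp only [hstate]

theorem integrable_sphere {g : Metric.sphere (0 : Ket) 1 → ℝ} (hg : Continuous g) :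
    Integrable g sphereMeasure :=
  hg.integrable_of_hasCompactSupport (HasCompactSupport.of_compactSpace g)

theorem integral_stateVec (j : Fin 3) : ∫ ψ, stateVec ψ j ∂sphereMeasure = 0 := by
  -- `α = 0`, `β = 1` are half-angle parameters, so these are half-turns, which flip the signs of
  -- two coordinates.
  have hq : (0 : ℝ) ^ 2 + 1 ^ 2 = 1 := by norm_num
  have hX := fun j => integral_stateVec_rotation (unitaryX 0 1 hq)
    (continuous_apply (A := fun _ => ℝ) j)
  have hZ := fun j => integral_stateVec_rotation (unitaryZ 0 1 hq)
    (continuous_apply (A := fun _ => ℝ) j)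
  rw [rotation_unitaryX] at hX
  rw [rotation_unitaryZ] at hZ
  have hX2 := hX 2
  have hZ0 := hZ 0
  have hZ1 := hZ 1
  simp [Matrix.mulVec, dotProduct, Fin.sum_univ_three, integral_neg] at hX2 hZ0 hZ1
  fin_cases j <;> simp <;> linarith

theorem integral_stateVec_mul_of_ne {j k : Fin 3} (hjk : j ≠ k) :
    ∫ ψ, stateVec ψ j * stateVec ψ k ∂sphereMeasure = 0 := by
  have hq : (0 : ℝ) ^ 2 + 1 ^ 2 = 1 := by norm_num
  have hg : ∀ j k : Fin 3, Continuous fun r : Fin 3 → ℝ => r j * r k := by fun_prop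
  have hX := fun j k => integral_stateVec_rotation (unitaryX 0 1 hq) (hg j k)
  have hZ := fun j k => integral_stateVec_rotation (unitaryZ 0 1 hq) (hg j k)
  rw [rotation_unitaryX] at hX
  rw [rotation_unitaryZ] at hZ
  have h1 := hX 0 1
  have h2 := hX 0 2
  have h3 := hZ 1 2
  simp [Matrix.mulVec, dotProduct, Fin.sum_univ_three, integral_neg] at h1 h2 h3
  have h1' : ∫ ψ, stateVec ψ 1 * stateVec ψ 0 ∂sphereMeasure = 0 := by
    simp only [mul_comm (stateVec _ 1)]; linarith
  have h2' : ∫ ψ, stateVec ψ 2 * stateVec ψ 0 ∂sphereMeasure = 0 := by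
    simp only [mul_comm (stateVec _ 2)]; linarith
  have h3' : ∫ ψ, stateVec ψ 2 * stateVec ψ 1 ∂sphereMeasure = 0 := by
    simp only [mul_comm (stateVec _ 2)]; linarith
  fin_cases j <;> fin_cases k <;> simp at hjk ⊢ <;> linarith

theorem integral_stateVec_sq (j : Fin 3) :
    ∫ ψ, stateVec ψ j * stateVec ψ j ∂sphereMeasure = sphereMeasure.real Set.univ / 12 := by
  -- Quarter-turns permute the axes up to sign, so the three second moments agree. They sum to a
  -- quarter of the total mass, since `stateVec` has length `1/2`.
  have hr : (√2 / 2) ^ 2 + (√2 / 2) ^ 2 = 1 := by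
    rw [div_pow, Real.sq_sqrt (by norm_num)]; norm_num
  have hs : 2 * (√2 / 2) * (√2 / 2) = 1 := by linarith
  have hg : ∀ j : Fin 3, Continuous fun r : Fin 3 → ℝ => r j * r j := by fun_prop
  have hX := fun j => integral_stateVec_rotation (unitaryX _ _ hr) (hg j)
  have hZ := fun j => integral_stateVec_rotation (unitaryZ _ _ hr) (hg j)
  rw [rotation_unitaryX, hs, sub_self] at hX
  rw [rotation_unitaryZ, hs, sub_self] at hZ
  have h1 := hX 2
  have h2 := hZ 1
  simp [Matrix.mulVec, dotProduct, Fin.sum_univ_three] at h1 h2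
  have hi : ∀ j, Integrable (fun ψ => stateVec ψ j * stateVec ψ j) sphereMeasure := fun j =>
    integrable_sphere ((continuous_stateVec j).mul (continuous_stateVec j))
  have h3 : ∫ ψ, (stateVec ψ 0 * stateVec ψ 0 + stateVec ψ 1 * stateVec ψ 1
      + stateVec ψ 2 * stateVec ψ 2) ∂sphereMeasure = sphereMeasure.real Set.univ / 4 := by
    have : ∀ ψ, stateVec ψ 0 * stateVec ψ 0 + stateVec ψ 1 * stateVec ψ 1
        + stateVec ψ 2 * stateVec ψ 2 = 1 / 4 := fun ψ => by
      rw [← stateVec_dotProduct_self ψ, dotProduct, Fin.sum_univ_three]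
    simp only [this]
    simp
    ring
  rw [integral_add (f := fun ψ => stateVec ψ 0 * stateVec ψ 0 + stateVec ψ 1 * stateVec ψ 1)
    ((hi 0).add (hi 1)) (hi 2), integral_add (hi 0) (hi 1)] at h3
  generalize sphereMeasure.real Set.univ = c at h3 ⊢
  fin_cases j <;> simp <;> linarith

theorem re_hsInner_add_blochOp (r s : Fin 3 → ℝ) :
    (hsInner ((1 / 2 : ℂ) • (1 : Op) + blochOp r) ((1 / 2 : ℂ) • (1 : Op) + blochOp s)).re
      = 1 / 2 + 2 * (r ⬝ᵥ s) := by
  have h : hsInner ((1 / 2 : ℂ) • (1 : Op)) ((1 / 2 : ℂ) • (1 : Op)) = 1 / 2 := by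
    simp [hsInner]
  have h2 : hsInner ((1 / 2 : ℂ) • (1 : Op)) (blochOp s) = 0 := by
    simp [hsInner, trace_blochOp]
  rw [hsInner_add_left, hsInner_add_right, hsInner_add_right, h, h2, hsInner_smul_right,
    hsInner_blochOp_one, hsInner_blochOp, mul_zero, add_zero, zero_add, Complex.add_re,
    Complex.ofReal_re]
  norm_num

/-- The translation `Φ 1 - 1` enters linearly in the Bloch vector and averages to zero. The
quadratic part is averaged with the isotropic second moment `1/12`, and the factor 2 in the
Hilbert-Schmidt product turns this into `1/6`. -/
theorem avgFidelity_eq {Φ : SuperOp} (hΦ : IsHermitianTP Φ) (u : U2) :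
    avgFidelity Φ (unitaryChannel u) = 1 / 2 + (bloch Φ * (rotation u)ᵀ).trace / 6 := by
  have hpos : sphereMeasure.real Set.univ ≠ 0 := by
    rw [Measure.toSphere_real_apply_univ]
    have : (volume : Measure Ket).real (Metric.ball 0 1) ≠ 0 :=
      (ENNReal.toReal_pos (Metric.measure_ball_pos _ _ one_pos).ne' measure_ball_lt_top.ne).ne'
    have h2 : Module.finrank ℝ Ket ≠ 0 := Module.finrank_pos.ne'
    positivity
  have hu1 : unitaryChannel u 1 = 1 := by
    rw [unitaryChannel_apply, mul_one]
    exact Matrix.mem_unitaryGroup_iff.1 u.2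
  have hint : ∀ ψ : Metric.sphere (0 : Ket) 1,
      (hsInner (Φ (pureState ψ)) (unitaryChannel u (pureState ψ))).re
      = 1 / 2 + (∑ j, (blochVec (Φ 1) ᵥ* rotation u) j * stateVec ψ j
        + ∑ j, ∑ k, 2 * ((bloch Φ)ᵀ * rotation u) j k * (stateVec ψ j * stateVec ψ k)) := by
    intro ψ
    have e1 : Φ (pureState ψ) = (1 / 2 : ℂ) • (1 : Op)
        + blochOp ((1 / 2 : ℝ) • blochVec (Φ 1) + bloch Φ *ᵥ stateVec ψ) := by
      have h1 : ((1 / 2 : ℝ) : ℂ) = 1 / 2 := by norm_num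
      rw [pureState_eq, map_add, map_smul, hΦ.map_one, hΦ.map_blochOp, smul_add,
        map_add blochOp, map_smul blochOp, ← Complex.coe_smul, h1, add_assoc, ← hΦ.map_one]
    have e2 : unitaryChannel u (pureState ψ) = (1 / 2 : ℂ) • (1 : Op)
        + blochOp (rotation u *ᵥ stateVec ψ) := by
      rw [pureState_eq, map_add, map_smul, hu1, unitaryChannel_blochOp]
    have e3 : (bloch Φ *ᵥ stateVec ψ) ⬝ᵥ (rotation u *ᵥ stateVec ψ)
        = stateVec ψ ⬝ᵥ (((bloch Φ)ᵀ * rotation u) *ᵥ stateVec ψ) := by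
      rw [← Matrix.mulVec_mulVec, Matrix.dotProduct_mulVec (stateVec ψ), Matrix.vecMul_transpose]
    rw [e1, e2, re_hsInner_add_blochOp, add_dotProduct, e3, smul_dotProduct,
      Matrix.dotProduct_mulVec (blochVec (Φ 1))]
    simp only [dotProduct, Matrix.mulVec, Finset.mul_sum, smul_eq_mul, mul_add]
    congr 2
    · exact Finset.sum_congr rfl fun j _ => by ring
    · exact Finset.sum_congr rfl fun j _ => Finset.sum_congr rfl fun k _ => by ring
  have hi1 : ∀ j, Integrable (fun ψ => stateVec ψ j) sphereMeasure := fun j =>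
    integrable_sphere (continuous_stateVec j)
  have hi2 : ∀ j k, Integrable (fun ψ => stateVec ψ j * stateVec ψ k) sphereMeasure := fun j k =>
    integrable_sphere ((continuous_stateVec j).mul (continuous_stateVec k))
  have hI1 : Integrable (fun ψ => ∑ j, (blochVec (Φ 1) ᵥ* rotation u) j * stateVec ψ j)
      sphereMeasure := integrable_finsetSum _ fun j _ => (hi1 j).const_mul _
  have hI2' : ∀ j, Integrable (fun ψ => ∑ k, 2 * ((bloch Φ)ᵀ * rotation u) j k
      * (stateVec ψ j * stateVec ψ k)) sphereMeasure := fun j =>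
    integrable_finsetSum _ fun k _ => (hi2 j k).const_mul _
  have hI2 : Integrable (fun ψ => ∑ j, ∑ k, 2 * ((bloch Φ)ᵀ * rotation u) j k
      * (stateVec ψ j * stateVec ψ k)) sphereMeasure := integrable_finsetSum _ fun j _ => hI2' j
  have hsum : ∀ j, ∑ k, 2 * ((bloch Φ)ᵀ * rotation u) j k
      * ∫ ψ, stateVec ψ j * stateVec ψ k ∂sphereMeasure
      = ((bloch Φ)ᵀ * rotation u) j j * (sphereMeasure.real Set.univ / 6) := by
    intro j
    rw [Finset.sum_eq_single j, integral_stateVec_sq]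
    · ring
    · intro k _ hk
      rw [integral_stateVec_mul_of_ne (Ne.symm hk), mul_zero]
    · simp
  have htr : ∑ j, ((bloch Φ)ᵀ * rotation u) j j = (bloch Φ * (rotation u)ᵀ).trace := by
    rw [← Matrix.trace_transpose (bloch Φ * (rotation u)ᵀ), Matrix.transpose_mul,
      Matrix.transpose_transpose, Matrix.trace_mul_comm]
    rfl
  rw [avgFidelity, average_eq]
  simp only [hint]
  rw [integral_add (g := fun ψ => ∑ j, (blochVec (Φ 1) ᵥ* rotation u) j * stateVec ψ j
        + ∑ j, ∑ k, 2 * ((bloch Φ)ᵀ * rotation u) j k * (stateVec ψ j * stateVec ψ k))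
      (integrable_const _) (hI1.add hI2), integral_add hI1 hI2,
    integral_finsetSum _ fun j _ => (hi1 j).const_mul _,
    integral_finsetSum _ fun j _ => hI2' j]
  simp only [integral_finsetSum _ fun k _ => (hi2 _ k).const_mul _, integral_const_mul,
    integral_stateVec, hsum, ← Finset.sum_mul, htr, integral_const]
  generalize sphereMeasure.real Set.univ = c at hpos ⊢
  simp
  field_simp

end Sphere

/-! ### Circuit averages as powers of the twirl -/

section Circuits

variable {ι : Type*}

theorem isHermitianTP_circuit {G : ι → SuperOp} (hG : ∀ i, IsHermitianTP (G i)) (m : ℕ)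
    (s : Fin m → ι) : IsHermitianTP (circuit G m s) := by
  induction m with
  | zero => exact IsHermitianTP.one
  | succ m ih => exact (hG _).mul (ih _)

theorem exists_circuit_eq_unitaryChannel (w : ι → U2) (m : ℕ) (s : Fin m → ι) :
    ∃ W, circuit (fun i => unitaryChannel (w i)) m s = unitaryChannel W := by
  induction m with
  | zero => exact ⟨1, unitaryChannel_one.symm⟩
  | succ m ih =>
    obtain ⟨W, hW⟩ := ih fun k => s k.castSucc
    exact ⟨w (s (Fin.last m)) * W, by rw [circuit, hW, unitaryChannel_mul]⟩

variable [Fintype ι]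

theorem sum_circuit [Nonempty ι] {G H : ι → SuperOp} (hG : ∀ i, IsHermitianTP (G i))
    (hH : ∀ i, IsHermitianTP (H i)) (m : ℕ) :
    ∑ s, bloch (circuit G m s) * (bloch (circuit H m s))ᵀ
      = (Fintype.card ι : ℝ) ^ m
        • (twirl (fun i => bloch (G i)) (fun i => bloch (H i)) ^ m) (1 : Mat3) := by
  induction m with
  | zero => simp [circuit, bloch_one]
  | succ m ih =>
    have hc := cast_card_pos (ι := ι)
    -- Splitting off the last gate, which acts outermost, exhibits one further application of the
    -- twirl.
    rw [← (Fin.snocEquiv fun _ => ι).sum_comp, Fintype.sum_prod_type]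
    have h : ∀ (i : ι) (s : Fin m → ι),
        bloch (circuit G (m + 1) (Fin.snocEquiv (fun _ => ι) (i, s)))
          * (bloch (circuit H (m + 1) (Fin.snocEquiv (fun _ => ι) (i, s))))ᵀ
        = bloch (G i) * (bloch (circuit G m s) * (bloch (circuit H m s))ᵀ) * (bloch (H i))ᵀ := by
      intro i s
      simp only [circuit, Fin.snocEquiv_apply, Fin.snoc_last, Fin.snoc_castSucc]
      rw [(hG i).bloch_mul (isHermitianTP_circuit hG m s),
        (hH i).bloch_mul (isHermitianTP_circuit hH m s), Matrix.transpose_mul]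
      simp only [mul_assoc]
    simp only [h, ← Finset.sum_mul, ← Finset.mul_sum, ih]
    rw [pow_succ' (twirl _ _), Module.End.mul_apply, twirl_apply, smul_smul, pow_succ,
      mul_assoc, mul_inv_cancel₀ hc.ne', mul_one, Finset.smul_sum]
    simp

/-- The circuit fidelity with respect to unitary gates is governed by powers of the twirl. -/
theorem gateSetFidelity_eq [Nonempty ι] {G : ι → SuperOp} (hG : ∀ i, IsHermitianTP (G i))
    (w : ι → U2) (m : ℕ) :
    gateSetFidelity G (fun i => unitaryChannel (w i)) m
      = 1 / 2 + ((twirl (fun i => bloch (G i)) (fun i => rotation (w i)) ^ m) 1).trace / 6 := by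
  have hc := cast_card_pos (ι := ι)
  have h : ∀ s : Fin m → ι,
      avgFidelity (circuit G m s) (circuit (fun i => unitaryChannel (w i)) m s)
      = 1 / 2 + (bloch (circuit G m s)
        * (bloch (circuit (fun i => unitaryChannel (w i)) m s))ᵀ).trace / 6 := by
    intro s
    obtain ⟨W, hW⟩ := exists_circuit_eq_unitaryChannel w m s
    rw [hW, avgFidelity_eq (isHermitianTP_circuit hG m s)]
    rfl
  have hsum := congrArg Matrix.trace
    (sum_circuit hG (fun i => isHermitianTP_unitaryChannel (w i)) m)
  rw [Matrix.trace_sum, Matrix.trace_smul, smul_eq_mul] at hsum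
  rw [gateSetFidelity]
  simp only [h]
  rw [Finset.sum_add_distrib, ← Finset.sum_div, ← Finset.sum_div, hsum]
  simp only [Finset.sum_const, Finset.card_univ, Fintype.card_pi, Finset.prod_const,
    Fintype.card_fin, nsmul_eq_mul, Nat.cast_pow, rotation]
  field_simp

end Circuits

/-! ### Spectrum of the twirling superchannel -/

section Superchannel

theorem liouville_succ_succ {Φ : SuperOp} (hΦ : IsHermitianTP Φ) (j k : Fin 3) :
    liouville Φ j.succ k.succ = (bloch Φ j k : ℂ) := by
  have h := hsInner_im_of_hermitian (pauli_conjTranspose j.succ)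
    (hΦ.hermitian _ (pauli_conjTranspose k.succ))
  rw [liouville, bloch, Matrix.of_apply, Matrix.of_apply, blochVec, Complex.ofReal_div,
    Complex.ofReal_ofNat]
  congr 1
  exact Complex.ext (by simp) (by simpa using h)

theorem liouville_zero_zero {Φ : SuperOp} (hΦ : IsHermitianTP Φ) : liouville Φ 0 0 = 1 := by
  simp [liouville, hsInner, pauli_zero, hΦ.trace]

theorem liouville_zero_succ {Φ : SuperOp} (hΦ : IsHermitianTP Φ) (k : Fin 3) :
    liouville Φ 0 k.succ = 0 := by
  simp [liouville, hsInner, pauli_zero, hΦ.trace, trace_pauli_succ]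

theorem tracelessProj_pauli_succ (k : Fin 3) : tracelessProj (pauli k.succ) = pauli k.succ := by
  simp [tracelessProj, trace_pauli_succ]

theorem tracelessProj_one : tracelessProj 1 = 0 := by
  simp [tracelessProj]

theorem liouville_tracelessProj_zero_right (Φ : SuperOp) (j : Fin 4) :
    liouville (Φ * tracelessProj) j 0 = 0 := by
  simp [liouville, hsInner, pauli_zero, tracelessProj_one]

theorem liouville_tracelessProj_zero_left {Φ : SuperOp} (hΦ : IsHermitianTP Φ) (k : Fin 4) :
    liouville (Φ * tracelessProj) 0 k = 0 := by
  refine Fin.cases (liouville_tracelessProj_zero_right Φ 0) (fun k => ?_) k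
  simp [liouville, hsInner, pauli_zero, tracelessProj_pauli_succ, hΦ.trace, trace_pauli_succ]

theorem liouville_tracelessProj_succ_succ {Φ : SuperOp} (hΦ : IsHermitianTP Φ) (j k : Fin 3) :
    liouville (Φ * tracelessProj) j.succ k.succ = (bloch Φ j k : ℂ) := by
  rw [← liouville_succ_succ hΦ]
  simp [liouville, tracelessProj_pauli_succ]

variable {ι : Type*} [Fintype ι] {G : ι → SuperOp} {u : ι → U2}

theorem twirlingSuperchannel_mulVec (w : Fin 4 × Fin 4 → ℂ) (j k : Fin 4) :
    (twirlingSuperchannel G (idealGates u) *ᵥ w) (j, k)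
      = (Fintype.card ι : ℂ)⁻¹ * ∑ i, ∑ j', ∑ k',
        liouville (unitaryChannel (u i) * tracelessProj) j j' * liouville (G i) k k' * w (j', k') := by
  have h : ∀ x, twirlingSuperchannel G (idealGates u) (j, k) x = (Fintype.card ι : ℂ)⁻¹ * ∑ i,
      liouville (unitaryChannel (u i) * tracelessProj) j x.1 * liouville (G i) k x.2 := by
    intro x
    rw [twirlingSuperchannel, Matrix.smul_apply, Matrix.sum_apply, smul_eq_mul]
    rfl
  simp only [Matrix.mulVec, dotProduct, h, mul_assoc, ← Finset.mul_sum, Finset.sum_mul]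
  rw [Finset.sum_comm]
  simp only [Fintype.sum_prod_type, Finset.mul_sum]

theorem twirlingSuperchannel_mulVec_zero (w : Fin 4 × Fin 4 → ℂ) (k : Fin 4) :
    (twirlingSuperchannel G (idealGates u) *ᵥ w) (0, k) = 0 := by
  simp [twirlingSuperchannel_mulVec,
    liouville_tracelessProj_zero_left (isHermitianTP_unitaryChannel _)]

/-- Trace preservation makes the first row of each noisy Liouville matrix `(1, 0, 0, 0)`, so these
components evolve among themselves under the mean rotation, which is zero for a 2-design. -/
theorem twirlingSuperchannel_mulVec_succ_zero (hG : ∀ i, IsHermitianTP (G i))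
    (w : Fin 4 × Fin 4 → ℂ) (j : Fin 3) :
    (twirlingSuperchannel G (idealGates u) *ᵥ w) (j.succ, 0)
      = (Fintype.card ι : ℂ)⁻¹ * ∑ j' : Fin 3, ((∑ i, rotation (u i)) j j' : ℂ) * w (j'.succ, 0) := by
  rw [twirlingSuperchannel_mulVec]
  simp only [Fin.sum_univ_succ (n := 3), liouville_tracelessProj_zero_right,
    liouville_tracelessProj_succ_succ (isHermitianTP_unitaryChannel _), zero_mul,
    Finset.sum_const_zero, zero_add, add_zero, liouville_zero_zero (hG _),
    liouville_zero_succ (hG _), mul_one, mul_zero]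
  rw [Finset.sum_comm]
  simp [Matrix.sum_apply, Finset.sum_mul, rotation]

/-- On vectors supported on the traceless part, the twirling superchannel acts as the complex
extension of the twirl. -/
theorem twirlingSuperchannel_mulVec_succ_succ (hG : ∀ i, IsHermitianTP (G i))
    {w : Fin 4 × Fin 4 → ℂ} (hw : ∀ j : Fin 3, w (j.succ, 0) = 0) {X Y : Mat3}
    (hXY : ∀ j k : Fin 3, w (j.succ, k.succ) = X k j + Y k j * Complex.I) (j k : Fin 3) :
    (twirlingSuperchannel G (idealGates u) *ᵥ w) (j.succ, k.succ)
      = (twirl (fun i => bloch (G i)) (fun i => rotation (u i)) X k j : ℂ)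
        + (twirl (fun i => bloch (G i)) (fun i => rotation (u i)) Y k j : ℂ) * Complex.I := by
  rw [twirlingSuperchannel_mulVec]
  simp only [Fin.sum_univ_succ (n := 3), liouville_tracelessProj_zero_right,
    liouville_tracelessProj_succ_succ (isHermitianTP_unitaryChannel _), zero_mul,
    Finset.sum_const_zero, zero_add, hw, mul_zero, liouville_succ_succ (hG _), hXY]
  simp only [twirl_apply, Matrix.smul_apply, Matrix.sum_apply, Matrix.mul_apply,
    Matrix.transpose_apply, smul_eq_mul, rotation]
  push_cast
  rw [mul_assoc, ← mul_add, Finset.sum_mul, ← Finset.sum_add_distrib]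
  congr 1
  refine Finset.sum_congr rfl fun i _ => ?_
  rw [Finset.sum_mul, ← Finset.sum_add_distrib]
  refine Finset.sum_congr rfl fun j' _ => ?_
  rw [Finset.sum_mul, Finset.sum_mul, Finset.sum_mul, ← Finset.sum_add_distrib]
  refine Finset.sum_congr rfl fun k' _ => ?_
  ring

theorem mem_spectrum_iff_exists_mulVec {n : Type*} [Fintype n] [DecidableEq n] (T : Matrix n n ℂ)
    (z : ℂ) : z ∈ spectrum ℂ T ↔ ∃ w, w ≠ 0 ∧ T *ᵥ w = z • w := by
  rw [← Matrix.spectrum_toLin', ← Module.End.hasEigenvalue_iff_mem_spectrum]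
  constructor
  · intro h
    obtain ⟨w, hw⟩ := h.exists_hasEigenvector
    exact ⟨w, hw.2, by simpa using hw.apply_eq_smul⟩
  · rintro ⟨w, hw0, hw⟩
    exact Module.End.hasEigenvalue_of_hasEigenvector
      ⟨Module.End.mem_eigenspace_iff.2 (by simpa using hw), hw0⟩

theorem mem_spectrum_twirlingSuperchannel (hG : ∀ i, IsHermitianTP (G i)) {p : ℝ} {A : Mat3}
    (hA0 : A ≠ 0)
    (hA : twirl (fun i => bloch (G i)) (fun i => rotation (u i)) A = p • A) :
    (p : ℂ) ∈ spectrum ℂ (twirlingSuperchannel G (idealGates u)) := by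
  rw [mem_spectrum_iff_exists_mulVec]
  -- The indices are transposed: the first tensor factor carries the ideal gate, which acts on `A`
  -- from the right.
  let w : Fin 4 × Fin 4 → ℂ := fun x =>
    Fin.cases 0 (fun j => Fin.cases 0 (fun k => (A k j : ℂ)) x.2) x.1
  have hw : ∀ j k : Fin 3, w (j.succ, k.succ) = A k j := fun j k => rfl
  refine ⟨w, fun h0 => hA0 ?_, ?_⟩
  · ext k j
    have := congrFun h0 (j.succ, k.succ)
    rw [hw] at this
    simpa using this
  · ext ⟨j, k⟩
    refine Fin.cases ?_ (fun j => ?_) j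
    · rw [twirlingSuperchannel_mulVec_zero]
      simp [w]
    · refine Fin.cases ?_ (fun k => ?_) k
      · rw [twirlingSuperchannel_mulVec_succ_zero hG]
        simp [w]
      · rw [twirlingSuperchannel_mulVec_succ_succ hG (X := A) (Y := 0) (fun _ => rfl)
          (fun j k => by simp [hw]), hA]
        simp [hw]

/-- For a nonzero eigenvalue the components outside the traceless block vanish. The real and
imaginary parts of the remaining block satisfy the twirl equation, and one of them is nonzero. -/
theorem exists_of_mem_spectrum_twirlingSuperchannel (hG : ∀ i, IsHermitianTP (G i))
    (hu : ∑ i, rotation (u i) = 0) {z : ℂ} (hz0 : z ≠ 0)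
    (hz : z ∈ spectrum ℂ (twirlingSuperchannel G (idealGates u))) :
    ∃ X Y : Mat3, (X ≠ 0 ∨ Y ≠ 0) ∧
      twirl (fun i => bloch (G i)) (fun i => rotation (u i)) X = z.re • X - z.im • Y ∧
      twirl (fun i => bloch (G i)) (fun i => rotation (u i)) Y = z.im • X + z.re • Y := by
  obtain ⟨w, hw0, hw⟩ := (mem_spectrum_iff_exists_mulVec _ _).1 hz
  have hw1 : ∀ k, w (0, k) = 0 := by
    intro k
    have h := congrFun hw (0, k)
    rw [twirlingSuperchannel_mulVec_zero] at h
    exact (mul_eq_zero.1 h.symm).resolve_left hz0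
  have hw2 : ∀ j : Fin 3, w (j.succ, 0) = 0 := by
    intro j
    have h := congrFun hw (j.succ, 0)
    rw [twirlingSuperchannel_mulVec_succ_zero hG, hu] at h
    simp only [Matrix.zero_apply, Complex.ofReal_zero, zero_mul, Finset.sum_const_zero,
      mul_zero] at h
    exact (mul_eq_zero.1 h.symm).resolve_left hz0
  let X : Mat3 := Matrix.of fun k j => (w (j.succ, k.succ)).re
  let Y : Mat3 := Matrix.of fun k j => (w (j.succ, k.succ)).im
  have hXY : ∀ j k : Fin 3, w (j.succ, k.succ) = X k j + Y k j * Complex.I :=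
    fun j k => (Complex.re_add_im _).symm
  have key : ∀ j k : Fin 3, (twirl (fun i => bloch (G i)) (fun i => rotation (u i)) X k j : ℂ)
        + (twirl (fun i => bloch (G i)) (fun i => rotation (u i)) Y k j : ℂ) * Complex.I
        = z * (X k j + Y k j * Complex.I) := by
    intro j k
    rw [← twirlingSuperchannel_mulVec_succ_succ hG hw2 hXY, hw, ← hXY]
    rfl
  refine ⟨X, Y, ?_, ?_, ?_⟩
  · by_contra hcon
    push Not at hcon
    apply hw0
    ext ⟨j, k⟩
    refine Fin.cases (hw1 k) (fun j => ?_) j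
    refine Fin.cases (hw2 j) (fun k => ?_) k
    rw [hXY, hcon.1, hcon.2]
    simp
  · ext k j
    simpa using congrArg Complex.re (key j k)
  · ext k j
    have := congrArg Complex.im (key j k)
    simp at this
    simp [this]
    ring

end Superchannel

/-! ### Choice of gauge and the decay law -/

section Alignment

open scoped Matrix.Norms.Frobenius

theorem isCompact_unitaryGroup :
    IsCompact {X : Op | X ∈ Matrix.unitaryGroup (Fin 2) ℂ} := by
  have hK : IsCompact (Set.univ.pi fun _ : Fin 2 => Set.univ.pi fun _ : Fin 2 =>
      Metric.closedBall (0 : ℂ) 1) :=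
    isCompact_univ_pi fun _ => isCompact_univ_pi fun _ => isCompact_closedBall _ _
  refine hK.of_isClosed_subset (X := Op) ?_ ?_
  · simp only [Matrix.mem_unitaryGroup_iff]
    exact isClosed_eq (by fun_prop) continuous_const
  · intro X hX i _ j _
    rw [mem_closedBall_zero_iff]
    exact entry_norm_bound_of_unitary hX i j

theorem continuous_rotation_apply (j k : Fin 3) : Continuous fun u : U2 => rotation u j k := by
  unfold rotation bloch blochVec hsInner
  simp only [Matrix.of_apply, unitaryChannel_apply]
  fun_prop

/-- First-order optimality in half-angle form: with `t = β/α` the hypothesis reads `t b ≤ t² a`, and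
for small `t` of the sign of `b` the linear term wins unless `b = 0`. -/
theorem eq_zero_of_forall_mul_le {a b : ℝ}
    (h : ∀ α β : ℝ, α ^ 2 + β ^ 2 = 1 → α * β * b ≤ β ^ 2 * a) : b = 0 := by
  have h1 : ∀ t : ℝ, t * b ≤ t ^ 2 * a := by
    intro t
    have hs : 0 < 1 + t ^ 2 := by positivity
    have hq := Real.sq_sqrt hs.le
    have hq0 : 0 < √(1 + t ^ 2) := Real.sqrt_pos.2 hs
    have h2 := h (1 / √(1 + t ^ 2)) (t / √(1 + t ^ 2)) (by
      rw [div_pow, div_pow, hq]; field_simp)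
    have h3 : 1 / √(1 + t ^ 2) * (t / √(1 + t ^ 2)) * b = t * b / (√(1 + t ^ 2)) ^ 2 := by
      field_simp
    have h4 : (t / √(1 + t ^ 2)) ^ 2 * a = t ^ 2 * a / (√(1 + t ^ 2)) ^ 2 := by
      field_simp
    rw [h3, h4] at h2
    exact (div_le_div_iff_of_pos_right (by positivity)).1 h2
  have hc : 0 < |a| + 1 := by positivity
  have h2 := h1 (b / (|a| + 1))
  have h3 : b / (|a| + 1) * b = b ^ 2 * (|a| + 1) / (|a| + 1) ^ 2 := by field_simp
  have h4 : (b / (|a| + 1)) ^ 2 * a = b ^ 2 * a / (|a| + 1) ^ 2 := by field_simp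
  rw [h3, h4, div_le_div_iff_of_pos_right (by positivity)] at h2
  nlinarith [le_abs_self a, sq_nonneg b]

/-- Every real matrix is symmetric after multiplication with the rotation best aligned with it. -/
theorem exists_rotation_symmetric (A : Mat3) :
    ∃ v : U2, (A * (rotation v)ᵀ)ᵀ = A * (rotation v)ᵀ ∧
      A.trace ≤ (A * (rotation v)ᵀ).trace := by
  have : CompactSpace U2 := isCompact_iff_compactSpace.1 isCompact_unitaryGroup
  have hcont : Continuous fun v : U2 => (A * (rotation v)ᵀ).trace := by
    simp only [Matrix.trace, Matrix.diag, Matrix.mul_apply, Matrix.transpose_apply]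
    exact continuous_finsetSum _ fun i _ => continuous_finsetSum _ fun j _ =>
      continuous_const.mul (continuous_rotation_apply i j)
  obtain ⟨v, -, hv⟩ := isCompact_univ.exists_isMaxOn Set.univ_nonempty hcont.continuousOn
  have hmax : ∀ w, (A * (rotation v)ᵀ * (rotation w)ᵀ).trace ≤ (A * (rotation v)ᵀ).trace := by
    intro w
    have h : (A * (rotation (w * v))ᵀ).trace ≤ (A * (rotation v)ᵀ).trace :=
      hv (Set.mem_univ (w * v))
    rwa [rotation_mul, Matrix.transpose_mul, ← mul_assoc] at h
  refine ⟨v, ?_, ?_⟩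
  -- Stationarity of the trace under rotations about each axis kills one antisymmetric entry of `B`.
  · generalize A * (rotation v)ᵀ = B at hmax
    have hX : B 2 1 - B 1 2 = 0 := by
      apply eq_zero_of_forall_mul_le (a := B 1 1 + B 2 2)
      intro α β h
      have h2 : α ^ 2 - β ^ 2 = 1 - 2 * β ^ 2 := by linarith
      have h1 := hmax (unitaryX α β h)
      rw [rotation_unitaryX, h2] at h1
      simp [Matrix.trace, Matrix.mul_apply, Fin.sum_univ_three] at h1
      nlinarith
    have hY : B 0 2 - B 2 0 = 0 := by
      apply eq_zero_of_forall_mul_le (a := B 0 0 + B 2 2)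
      intro α β h
      have h2 : α ^ 2 - β ^ 2 = 1 - 2 * β ^ 2 := by linarith
      have h1 := hmax (unitaryY α β h)
      rw [rotation_unitaryY, h2] at h1
      simp [Matrix.trace, Matrix.mul_apply, Fin.sum_univ_three] at h1
      nlinarith
    have hZ : B 1 0 - B 0 1 = 0 := by
      apply eq_zero_of_forall_mul_le (a := B 0 0 + B 1 1)
      intro α β h
      have h2 : α ^ 2 - β ^ 2 = 1 - 2 * β ^ 2 := by linarith
      have h1 := hmax (unitaryZ α β h)
      rw [rotation_unitaryZ, h2] at h1
      simp [Matrix.trace, Matrix.mul_apply, Fin.sum_univ_three] at h1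
      nlinarith
    ext i j
    fin_cases i <;> fin_cases j <;> simp <;> linarith
  · have h := hv (Set.mem_univ 1)
    simpa [rotation_one] using h

theorem rotate_idealGates {ι : Type*} (v : U2) (u : ι → U2) :
    rotate v (idealGates u) = fun i => unitaryChannel (v * u i * v⁻¹) := by
  ext1 i
  rw [rotate, idealGates, unitaryChannel_mul, unitaryChannel_mul]

variable {ι : Type*} [Fintype ι] {M O : ι → Mat3} {V : Mat3}

/-- Right multiplication by `Vᵀ` intertwines the two twirls. The gauge change therefore keeps
eigenvalues and moves the eigenvector relative to the starting point `1`. -/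
theorem twirl_conj (hV : Vᵀ * V = 1) (X : Mat3) :
    twirl M (fun i => V * O i * Vᵀ) (X * Vᵀ) = twirl M O X * Vᵀ := by
  rw [twirl_apply, twirl_apply, Matrix.smul_mul, Finset.sum_mul]
  congr 1
  refine Finset.sum_congr rfl fun i _ => ?_
  calc _ = M i * X * (Vᵀ * V) * (O i)ᵀ * Vᵀ := by
        simp only [Matrix.transpose_mul, Matrix.transpose_transpose, mul_assoc]
    _ = _ := by rw [hV, mul_one]

theorem IsOrthogonalTwirl.conj (hO : IsOrthogonalTwirl O) (hV : Vᵀ * V = 1) :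
    IsOrthogonalTwirl fun i => V * O i * Vᵀ := by
  have hV' : V * Vᵀ = 1 := mul_eq_one_comm.1 hV
  refine ⟨fun i => ?_, fun X => ?_⟩
  · calc _ = V * ((O i)ᵀ * (Vᵀ * V) * O i) * Vᵀ := by
          simp only [Matrix.transpose_mul, Matrix.transpose_transpose, mul_assoc]
      _ = 1 := by rw [hV, mul_one, hO.orthogonal, mul_one, hV']
  · have h := hO.twirl_self (Vᵀ * X * V)
    rw [Matrix.trace_mul_comm, ← mul_assoc, hV', one_mul] at h
    have h2 : twirl (fun i => V * O i * Vᵀ) (fun i => V * O i * Vᵀ) X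
        = V * twirl O O (Vᵀ * X * V) * Vᵀ := by
      rw [twirl_apply, twirl_apply, Matrix.mul_smul, Matrix.smul_mul, Finset.mul_sum,
        Finset.sum_mul]
      congr 1
      refine Finset.sum_congr rfl fun i _ => ?_
      simp only [Matrix.transpose_mul, Matrix.transpose_transpose, mul_assoc]
    rw [h2, h, Matrix.mul_smul, mul_one, Matrix.smul_mul, hV']

/-- Normalizing an aligned matrix near the identity. -/
theorem norm_normalized_sub_one_le {A B : Mat3} (hA : A.trace = 3) (hA1 : ‖A - 1‖ ≤ 1 / 10)
    (hBA : ‖B‖ = ‖A‖) (htr : A.trace ≤ B.trace) : ‖(3 / B.trace) • B - 1‖ ≤ 1 / 4 := by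
  -- At equal norm, a larger trace means a smaller distance to `1`.
  have h1 : ‖B - 1‖ ≤ 1 / 10 := by
    refine le_trans (le_of_sq_le_sq ?_ (norm_nonneg _)) hA1
    rw [sq_norm_sub, sq_norm_sub, hBA, Matrix.transpose_one, mul_one, mul_one]
    linarith
  have h2 : B.trace - 3 ≤ 1 / 5 := by
    have h := abs_trace_le (B - 1)
    rw [Matrix.trace_sub, Matrix.trace_one, Fintype.card_fin] at h
    push_cast at h
    linarith [le_abs_self (B.trace - 3)]
  have hpos : 0 < B.trace := by linarith
  have hs1 : 3 / B.trace ≤ 1 := by rw [div_le_one hpos]; linarith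
  have hs2 : 15 / 16 ≤ 3 / B.trace := by rw [le_div_iff₀ hpos]; linarith
  have h3 : (3 / B.trace) • B - 1 = (3 / B.trace) • (B - 1) - (1 - 3 / B.trace) • (1 : Mat3) := by
    module
  rw [h3]
  calc _ ≤ ‖(3 / B.trace) • (B - 1)‖ + ‖(1 - 3 / B.trace) • (1 : Mat3)‖ := norm_sub_le _ _
    _ = 3 / B.trace * ‖B - 1‖ + (1 - 3 / B.trace) * ‖(1 : Mat3)‖ := by
      rw [norm_smul, norm_smul, Real.norm_of_nonneg (by positivity),
        Real.norm_of_nonneg (by linarith)]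
    _ ≤ 1 * (1 / 10) + 1 / 16 * 2 := by
      gcongr
      · linarith
      · exact norm_one_le
    _ ≤ 1 / 4 := by norm_num

variable [Nonempty ι]

/-- The decay law with explicit constants. -/
theorem exists_decayParameter {u : ι → U2} {Gn : ι → SuperOp} (hu : IsTwoDesign u)
    (hGn : ∀ i, IsChannel (Gn i))
    (hε : 1 - gateSetFidelity Gn (idealGates u) 1 ≤ 1 / 10 ^ 10) :
    ∃ p : ℝ, IsRBDecayParameter Gn (idealGates u) p ∧ ∃ v : U2, ∀ m : ℕ,
      |gateSetFidelity Gn (rotate v (idealGates u)) m - (1 / 2 + (2 - 1) / 2 * p ^ m)|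
        ≤ 25000 * (1 - p) ^ 2 := by
  have hG := fun i => (hGn i).isHermitianTP
  have hM := fun i => (hGn i).isContraction
  have hO := hu.isOrthogonalTwirl
  have hfid := gateSetFidelity_eq hG u 1
  rw [pow_one] at hfid
  have hgates : idealGates u = fun i => unitaryChannel (u i) := rfl
  rw [hgates, hfid] at hε
  obtain ⟨S, hSdef⟩ : ∃ S, S = twirl (fun i => bloch (Gn i)) fun i => rotation (u i) := ⟨_, rfl⟩
  -- `6 - 2 tr S(1)` is 12 times the infidelity, hence at most `12 / 10 ^ 10`, below the square of
  -- `1 / 10000`.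
  have hS : ∀ X, ‖S X - (X.trace / 3) • (1 : Mat3)‖ ≤ 1 / 10000 * ‖X‖ := by
    intro X
    apply le_of_sq_le_sq _ (by positivity)
    rw [hSdef, mul_pow]
    refine (sq_norm_twirl_sub_le hM hO X).trans ?_
    gcongr
    linarith
  obtain ⟨p, A, hA, hAtr, hA1, hp⟩ := exists_eigenvector_near_one (by norm_num) hS
  have hp' := abs_le.1 hp
  have hA0 : A ≠ 0 := by rintro rfl; simp at hAtr
  have hA2 : ‖A‖ ≤ 2 := by
    have h := sq_norm_sub A 1
    rw [sq_norm_one, Matrix.transpose_one, mul_one, hAtr] at h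
    nlinarith [norm_nonneg A, norm_nonneg (A - 1)]
  have hS0 : ∀ X, X.trace = 0 → ‖S X‖ ≤ 1 / 10000 * ‖X‖ := by
    intro X hX
    simpa [hX] using hS X
  refine ⟨p, ⟨mem_spectrum_twirlingSuperchannel hG hA0 (hSdef ▸ hA), fun z hz => ?_⟩, ?_⟩
  · by_cases hz0 : z = 0
    · rw [hz0, norm_zero]; linarith
    obtain ⟨X, Y, hne, hX, hY⟩ :=
      exists_of_mem_spectrum_twirlingSuperchannel hG hu.sum_rotation hz0 hz
    rw [← hSdef] at hX hY
    have h := normSq_eigenvalue_le hS0 (by norm_num) (by linarith) hA2 hAtr hA hX hY hne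
    apply le_of_sq_le_sq _ (by linarith)
    rwa [← Complex.normSq_eq_norm_sq, Complex.normSq_apply, ← sq, ← sq]
  · obtain ⟨v, hsymm, htr⟩ := exists_rotation_symmetric A
    refine ⟨v, fun m => ?_⟩
    have hV := rotation_transpose_mul_self v
    obtain ⟨B, hB⟩ : ∃ B, B = A * (rotation v)ᵀ := ⟨_, rfl⟩
    rw [← hB] at hsymm htr
    have hBA : ‖B‖ = ‖A‖ := hB ▸ norm_mul_transpose_of_orthogonal hV A
    have hBtr : B.trace ≠ 0 := by linarith
    have hBeig : twirl (fun i => bloch (Gn i))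
        (fun i => rotation v * rotation (u i) * (rotation v)ᵀ) B = p • B := by
      rw [hB, twirl_conj hV, ← hSdef, hA, Matrix.smul_mul]
    have key := abs_trace_twirl_pow_sub_le (A := (3 / B.trace) • B) (p := p) hM (hO.conj hV)
      (by rw [map_smul, hBeig, smul_comm])
      (by rw [Matrix.trace_smul, smul_eq_mul, div_mul_cancel₀ _ hBtr])
      (by rw [Matrix.transpose_smul, hsymm])
      (norm_normalized_sub_one_le hAtr hA1 hBA htr)
      (decay_le_one hM hO (hSdef ▸ hA) hA0) (by linarith) m
    rw [rotate_idealGates, gateSetFidelity_eq hG]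
    simp only [rotation_mul, rotation_inv]
    rw [abs_le] at key ⊢
    -- The fidelity error is half the error in `tr Sᵐ(1)/3`, which halves the constant 50000.
    constructor <;> linarith

end Alignment

end QubitRB

theorem proposition1 :
    ∃ ε : ℝ, 0 < ε ∧ ∃ K : ℝ, 0 < K ∧
      ∀ (ι : Type*) [Fintype ι] [Nonempty ι] (u : ι → Matrix.unitaryGroup (Fin 2) ℂ)
        (Gn : ι → QubitRB.SuperOp),
        QubitRB.IsTwoDesign u →
        (∀ i, QubitRB.IsChannel (Gn i)) →
        1 - QubitRB.gateSetFidelity Gn (QubitRB.idealGates u) 1 ≤ ε →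
        ∃ p : ℝ, QubitRB.IsRBDecayParameter Gn (QubitRB.idealGates u) p ∧
          ∃ v : Matrix.unitaryGroup (Fin 2) ℂ, ∀ m : ℕ,
            |QubitRB.gateSetFidelity Gn (QubitRB.rotate v (QubitRB.idealGates u)) m
                - (1 / 2 + (2 - 1) / 2 * p ^ m)| ≤ K * (1 - p) ^ 2 :=
  ⟨1 / 10 ^ 10, by norm_num, 25000, by norm_num, fun _ _ _ _ _ hu hGn hε =>
    QubitRB.exists_decayParameter hu hGn hε⟩
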